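/- Let $\mathsf k$ be a field, let $n\ge 1$, and let $M$ be a matroid of rank $\ell$ on the ground set $[n]=\{1,\dots,n\}$. Let $V=\mathsf k^n$ with standard basis $e_1,\dots,e_n$, let $E=\Lambda(V)$, and let $\partial$ be the derivation of $E$ with $\partial(e_i)=1$ for all $i$. The Orlik--Solomon algebra of $M$ is the graded algebra $A(M)=E/I$, where $I$ is the two-sided ideal generated by the elements $\partial(e_C)$ for all circuits $C$ of $M$, and $e_C=\prod_{i\in C}e_i$ with indices in increasing order. For $v=(v_1,\dots,v_n)\in V$ let $H^p(A(M),v)$ be the degree-$p$ cohomology of the cochain complex $A(M)$ whose differential is right multiplication by $v$, and let $$\mathcal R^p(M)=\{v\in V: H^p(A(M),v)\neq 0\}.$$ For $X\subseteq[n]$ let $P_{\{X,[n]-X\}}=\{v\in V:\sum_{i\in X}v_i=0=\sum_{i\notin X}v_i\}$. A flat $X$ of $M$ is called irreducible if it is nonempty and the restriction of $M$ to $X$ is connected, that is, any two distinct elements of $X$ lie in a common circuit of $M$ contained in $X$. Then for all $0\le p\le \ell$, $$\mathcal R^p(M)\subseteq\bigcup_{X}P_{\{X,[n]-X\}},$$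 where $X$ runs over the irreducible flats of $M$ of rank at most $p+1$. In other words, if $H^p(A(M),v)\neq0$, then there is an irreducible flat $X$ of rank at most $p+1$ for which $\sum_{i=1}^n v_i=0$ and $\sum_{i\in X}v_i=0$. -/

import Mathlib

noncomputable section

namespace HigherResonance

/-! ### The Orlik-Solomon algebra of a matroid on `Fin n` -/

/-- The exterior algebra `E = Λ(V)` of `V = kⁿ`. -/
abbrev Ext (k : Type*) [Field k] (n : ℕ) : Type _ :=
  ExteriorAlgebra k (Fin n → k)

/-- The linear form on `V = kⁿ` that takes the value `1` on every standard basis vector. -/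
def sumForm (k : Type*) [Field k] (n : ℕ) : Module.Dual k (Fin n → k) :=
  ∑ i : Fin n, LinearMap.proj i

/-- The derivation `∂` on `E` with `∂ eᵢ = 1` for all `i`: contraction with `sumForm`. -/
def extBoundary (k : Type*) [Field k] (n : ℕ) : Ext k n →ₗ[k] Ext k n :=
  CliffordAlgebra.contractLeft (sumForm k n)

/-- The standard basis vector `eᵢ`, as an element of `E`. -/
def extE (k : Type*) [Field k] {n : ℕ} (i : Fin n) : Ext k n :=
  ExteriorAlgebra.ι k (Pi.single i (1 : k))

/-- The monomial `e_C`, the product of the `eᵢ` for `i ∈ C` in increasing order. -/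
def extMonomial (k : Type*) [Field k] {n : ℕ} (C : Finset (Fin n)) : Ext k n :=
  (C.sort.map (extE k)).prod

/-- The Orlik-Solomon ideal, the two-sided ideal generated by `∂ e_C` for the circuits `C`. -/
def osIdeal (k : Type*) [Field k] {n : ℕ} (M : Matroid (Fin n)) : TwoSidedIdeal (Ext k n) :=
  TwoSidedIdeal.span
    {x | ∃ C : Finset (Fin n), M.IsCircuit (C : Set (Fin n)) ∧
      x = extBoundary k n (extMonomial k C)}

/-- The Orlik-Solomon algebra `A(M) = E / I(M)`. -/
abbrev OSAlgebra (k : Type*) [Field k] {n : ℕ} (M : Matroid (Fin n)) : Type _ :=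
  (osIdeal k M).ringCon.Quotient

/-- The quotient map `E → A(M)`. -/
def osMk (k : Type*) [Field k] {n : ℕ} (M : Matroid (Fin n)) : Ext k n →ₐ[k] OSAlgebra k M :=
  (osIdeal k M).ringCon.mkₐ k

/-- The image in `A(M)` of a vector `v ∈ V`. -/
def osVec (k : Type*) [Field k] {n : ℕ} (M : Matroid (Fin n)) (v : Fin n → k) : OSAlgebra k M :=
  osMk k M (ExteriorAlgebra.ι k v)

/-- The graded piece `A^p(M)`, the image of `Λ^p(V)`. -/
def osDegree (k : Type*) [Field k] {n : ℕ} (M : Matroid (Fin n)) (p : ℕ) :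
    Submodule k (OSAlgebra k M) :=
  (⋀[k]^p (Fin n → k)).map (osMk k M).toLinearMap

/-! ### The complex `(A(M), ·v)` and the resonance varieties -/

/-- The `p`-cocycles: the elements of `A^p` that right multiplication by `v` sends to `0`. -/
def cocycles {k : Type*} [Field k] {n : ℕ} (M : Matroid (Fin n)) (v : Fin n → k) (p : ℕ) :
    Submodule k (OSAlgebra k M) :=
  osDegree k M p ⊓ LinearMap.ker (LinearMap.mulRight k (osVec k M v))

/-- The `p`-coboundaries: the image of `A^{p-1}` under right multiplication by `v`, where
`A^{-1} = 0`. -/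
def coboundaries {k : Type*} [Field k] {n : ℕ} (M : Matroid (Fin n)) (v : Fin n → k) :
    ℕ → Submodule k (OSAlgebra k M)
  | 0 => ⊥
  | p + 1 => (osDegree k M p).map (LinearMap.mulRight k (osVec k M v))

theorem coboundaries_le_cocycles {k : Type*} [Field k] {n : ℕ} (M : Matroid (Fin n))
    (v : Fin n → k) (p : ℕ) : coboundaries M v p ≤ cocycles M v p := by
  cases p with
  | zero => exact bot_le
  | succ p =>
    rintro _ ⟨_, ⟨y, hy, rfl⟩, rfl⟩
    refine ⟨⟨y * ExteriorAlgebra.ι k v, ?_, ?_⟩, ?_⟩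
    · rw [SetLike.mem_coe, ExteriorAlgebra.exteriorPower, pow_succ]
      exact Submodule.mul_mem_mul hy (LinearMap.mem_range_self _ v)
    · simp [osVec]
    · simp only [LinearMap.mem_ker, SetLike.mem_coe, AlgHom.toLinearMap_apply,
        LinearMap.mulRight_apply, osVec]
      rw [mul_assoc, ← map_mul, ExteriorAlgebra.ι_sq_zero, map_zero, mul_zero]

/-- The cohomology `H^p(A(M), ·v)`, cocycles modulo coboundaries. -/
abbrev OSCohomology {k : Type*} [Field k] {n : ℕ} (M : Matroid (Fin n)) (v : Fin n → k)
    (p : ℕ) : Type _ :=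
  cocycles M v p ⧸ (coboundaries M v p).submoduleOf (cocycles M v p)

/-- The resonance variety `R^p_d(M) = {v ∈ V : dim H^p(A(M), ·v) ≥ d}`. -/
def resonance (k : Type*) [Field k] {n : ℕ} (M : Matroid (Fin n)) (p d : ℕ) : Set (Fin n → k) :=
  {v | (d : Cardinal) ≤ Module.rank k (OSCohomology M v p)}

/-! ### Irreducible flats and the subspaces `P_π` -/

/-- A matroid is connected (irreducible) if its ground set is nonempty and any two distinct
elements lie in a common circuit. -/
def IsConnected {α : Type*} (N : Matroid α) : Prop :=
  N.E.Nonempty ∧ ∀ e ∈ N.E, ∀ f ∈ N.E, e ≠ f → ∃ C, N.IsCircuit C ∧ e ∈ C ∧ f ∈ C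

/-- The set `L^irr_{≤ r}(M)` of flats `X` of rank at most `r` for which the restriction of `M`
to `X` is connected. -/
def irrFlats {n : ℕ} (M : Matroid (Fin n)) (r : ℕ) : Set (Finset (Fin n)) :=
  {X | M.IsFlat (X : Set (Fin n)) ∧ IsConnected (M.restrict (X : Set (Fin n))) ∧
    M.eRk (X : Set (Fin n)) ≤ r}

/-- The subspace `P_π ⊆ kⁿ` cut out by the equations `∑_{j ∈ B} x_j = 0`, one for each block
`B` of `π` (an empty block imposes no condition). -/
def partSubspace (k : Type*) [Field k] {n : ℕ} (π : Set (Finset (Fin n))) :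
    Submodule k (Fin n → k) where
  carrier := {x | ∀ B ∈ π, ∑ j ∈ B, x j = 0}
  zero_mem' := fun B _ => by simp
  add_mem' := fun hx hy B hB => by simp [Finset.sum_add_distrib, hx B hB, hy B hB]
  smul_mem' := fun c x hx B hB => by simp [← Finset.mul_sum, hx B hB]

end HigherResonance

end

/-! For a flat Z, killing the e_i with i ∉ Z retracts A = A(M) onto the subalgebra A_Z generated by
the e_i with i ∈ Z, and A^r is the direct sum of the A_Z^r over the flats Z of rank r
(`sum_osProj`). If X ⊆ Z is a union of connected components of M|Z, contraction with the sum of the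
coordinates in X descends to A_Z and is a homotopy from 0 to multiplication by the scalar ∑_{i ∈ X}
u_i. So multiplication by u is exact on A_Z as soon as this scalar is nonzero (`scDiff_exact`).
Taking the whole ground set for Z and X settles the case ∑ v_i ≠ 0.

Let ∑ v_i = 0, let M be loopless (a loop makes A zero), and suppose that v has nonzero sum on every
irreducible flat of rank at most p + 1. A nonempty flat Z has a component that is an irreducible
flat of rank at most rk Z (`exists_component`), so v is exact on A_Z whenever 1 ≤ rk Z ≤ p + 1. A
generic vector w over k(t) is exact on all these A_Z, and on A itself.

Local exactness determines the complex. For r = rk Z ≥ 1 the piece A_Z^r is the top degree of A_Z,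
so it consists of coboundaries and is the quotient of A_Z^{r-1} by its cocycles, which exactness
describes in lower degree. By induction on the degree, the complexes of v and w are isomorphic in
degrees at most p + 1, and H^p depends only on these degrees. The isomorphism is carried as a
relation `corr`, shown to be everywhere defined (`corr_exists`) and single-valued (`corr_eq_zero`).
A k-linear retraction of k(t) onto k brings exactness back to k. -/

noncomputable section
namespace HigherResonance

/-! ### Complexes filtered by the flats of a ranked family -/

/-- A graded module `G` with projections `P Z`, indexed by a finite ranked
family, that decompose every graded piece `G r` into the parts of rank `r`. -/
structure FlatProjections {K B F : Type*} [Field K] [AddCommGroup B] [Module K B]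
    (rk : F → ℕ) (G : ℕ → Submodule K B) (P : F → B →ₗ[K] B) : Prop where
  map_mem : ∀ Z r x, x ∈ G r → P Z x ∈ G r
  idem : ∀ Z x, P Z (P Z x) = P Z x
  comp_eq : ∀ Z W, (∀ x ∈ G (rk W), P W (P Z x) = P W x) ∨ (∀ x ∈ G (rk W), P W (P Z x) = 0)
  orth : ∀ Z W, Z ≠ W → rk Z = rk W → ∀ x ∈ G (rk W), P W (P Z x) = 0
  eq_zero : ∀ r x, x ∈ G r → (∀ Z, rk Z = r → P Z x = 0) → x = 0
  of_rank_lt : ∀ Z r x, x ∈ G r → rk Z < r → P Z x = 0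
  degree_zero : ∀ Z x, x ∈ G 0 → P Z x = x

/-- A differential of degree one, compatible with the projections, that is exact on the image of
every projection of rank between `1` and `m`. -/
structure LocallyExact {K B F : Type*} [Field K] [AddCommGroup B] [Module K B]
    (rk : F → ℕ) (G : ℕ → Submodule K B) (P : F → B →ₗ[K] B) (m : ℕ) (d : B →ₗ[K] B) :
    Prop where
  map_mem : ∀ r x, x ∈ G r → d x ∈ G (r + 1)
  sq_zero : ∀ x, d (d x) = 0
  compat : ∀ Z x, P Z (d (P Z x)) = P Z (d x)
  exact_zero : ∀ Z, 1 ≤ rk Z → rk Z ≤ m → ∀ x ∈ G 0, P Z (d x) = 0 → P Z x = 0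
  exact_succ : ∀ Z, 1 ≤ rk Z → rk Z ≤ m → ∀ r, ∀ x ∈ G (r + 1), P Z (d x) = 0 →
    ∃ y ∈ G r, P Z x = P Z (d y)

section Transfer

variable {K B F : Type*} [Field K] [AddCommGroup B] [Module K B]
  {rk : F → ℕ} {G : ℕ → Submodule K B} {P : F → B →ₗ[K] B} {m : ℕ} {d₁ d₂ : B →ₗ[K] B}

/-- The correspondence between two locally exact differentials, defined degree by degree. -/
def corr (rk : F → ℕ) (G : ℕ → Submodule K B) (P : F → B →ₗ[K] B) (d₁ d₂ : B →ₗ[K] B) :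
    ℕ → B → B → Prop
  | 0 => fun x y => x ∈ G 0 ∧ x = y
  | r + 1 => fun x y => x ∈ G (r + 1) ∧ y ∈ G (r + 1) ∧ ∀ Z, rk Z = r + 1 →
      ∃ b c, corr rk G P d₁ d₂ r b c ∧ P Z x = P Z (d₁ b) ∧ P Z y = P Z (d₂ c)

theorem corr_left_mem {r : ℕ} {x y : B} (h : corr rk G P d₁ d₂ r x y) : x ∈ G r := by
  cases r with
  | zero => exact h.1
  | succ r => exact h.1

theorem corr_symm {r : ℕ} {x y : B} (h : corr rk G P d₁ d₂ r x y) :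
    corr rk G P d₂ d₁ r y x := by
  induction r generalizing x y with
  | zero => exact ⟨h.2 ▸ h.1, h.2.symm⟩
  | succ r ih =>
    refine ⟨h.2.1, h.1, fun Z hZ => ?_⟩
    obtain ⟨b, c, hbc, hb, hc⟩ := h.2.2 Z hZ
    exact ⟨c, b, ih hbc, hc, hb⟩

theorem corr_right_mem {r : ℕ} {x y : B} (h : corr rk G P d₁ d₂ r x y) : y ∈ G r :=
  corr_left_mem (corr_symm h)

theorem corr_zero (r : ℕ) : corr rk G P d₁ d₂ r 0 0 := by
  induction r with
  | zero => exact ⟨zero_mem _, rfl⟩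
  | succ r ih => exact ⟨zero_mem _, zero_mem _, fun Z _ => ⟨0, 0, ih, by simp, by simp⟩⟩

theorem corr_sub {r : ℕ} {x y x' y' : B} (h : corr rk G P d₁ d₂ r x y)
    (h' : corr rk G P d₁ d₂ r x' y') : corr rk G P d₁ d₂ r (x - x') (y - y') := by
  induction r generalizing x y x' y' with
  | zero => exact ⟨sub_mem h.1 h'.1, by rw [h.2, h'.2]⟩
  | succ r ih =>
    refine ⟨sub_mem h.1 h'.1, sub_mem h.2.1 h'.2.1, fun Z hZ => ?_⟩
    obtain ⟨b, c, hbc, hb, hc⟩ := h.2.2 Z hZ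
    obtain ⟨b', c', hbc', hb', hc'⟩ := h'.2.2 Z hZ
    exact ⟨b - b', c - c', ih hbc hbc', by simp [hb, hb'], by simp [hc, hc']⟩

theorem corr_d (h₁ : LocallyExact rk G P m d₁) (h₂ : LocallyExact rk G P m d₂)
    {r : ℕ} {x y : B} (h : corr rk G P d₁ d₂ r x y) :
    corr rk G P d₁ d₂ (r + 1) (d₁ x) (d₂ y) :=
  ⟨h₁.map_mem _ _ (corr_left_mem h), h₂.map_mem _ _ (corr_right_mem h),
    fun _ _ => ⟨x, y, h, rfl, rfl⟩⟩

/-- In the degree of W, `P W ∘ P Z` is `P W` or zero, so the defining condition at W is inherited or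
trivial. This lets the uniqueness argument work inside one flat. -/
theorem corr_proj (hP : FlatProjections rk G P) {r : ℕ} {x y : B}
    (h : corr rk G P d₁ d₂ r x y) (Z : F) : corr rk G P d₁ d₂ r (P Z x) (P Z y) := by
  cases r with
  | zero =>
    exact ⟨hP.map_mem _ _ _ h.1, by rw [h.2]⟩
  | succ r =>
    refine ⟨hP.map_mem _ _ _ h.1, hP.map_mem _ _ _ h.2.1, fun W hW => ?_⟩
    rcases hP.comp_eq Z W with hc | hc
    · rw [hc _ (hW ▸ h.1), hc _ (hW ▸ h.2.1)]
      exact h.2.2 W hW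
    · rw [hc _ (hW ▸ h.1), hc _ (hW ▸ h.2.1)]
      exact ⟨0, 0, corr_zero r, by simp, by simp⟩

/-- Each top-degree component of x is locally a coboundary of some b. A partner c of b exists by
induction, and the components `P Z (d₂ c)` glue to a partner of x. -/
theorem corr_exists [Finite F] (hP : FlatProjections rk G P) (h₁ : LocallyExact rk G P m d₁)
    (h₂ : LocallyExact rk G P m d₂) {r : ℕ} (hr : r ≤ m) {x : B} (hx : x ∈ G r) :
    ∃ y, corr rk G P d₁ d₂ r x y := by
  induction r generalizing x with
  | zero => exact ⟨x, hx, rfl⟩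
  | succ r ih =>
    have key : ∀ Z, ∃ b c, rk Z = r + 1 → corr rk G P d₁ d₂ r b c ∧ P Z x = P Z (d₁ b) := by
      intro Z
      by_cases hZ : rk Z = r + 1
      -- `d₁ x` has degree r + 2, above the rank r + 1 of Z.
      · have h0 : P Z (d₁ x) = 0 := hP.of_rank_lt Z (r + 2) _ (h₁.map_mem _ _ hx) (by omega)
        obtain ⟨b, hb, hbx⟩ := h₁.exact_succ Z (by omega) (by omega) r x hx h0
        obtain ⟨c, hc⟩ := ih (by omega) hb
        exact ⟨b, c, fun _ => ⟨hc, hbx⟩⟩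
      · exact ⟨0, 0, fun h => absurd h hZ⟩
    choose b c hbc using key
    classical
    have := Fintype.ofFinite F
    have hmem : ∀ Z, rk Z = r + 1 → P Z (d₂ (c Z)) ∈ G (r + 1) := fun Z hZ =>
      hP.map_mem _ _ _ (h₂.map_mem _ _ (corr_right_mem (hbc Z hZ).1))
    refine ⟨∑ Z with rk Z = r + 1, P Z (d₂ (c Z)), hx,
      Submodule.sum_mem _ fun Z hZ => hmem Z (Finset.mem_filter.1 hZ).2, fun W hW =>
      ⟨b W, c W, (hbc W hW).1, (hbc W hW).2, ?_⟩⟩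
    rw [map_sum, Finset.sum_eq_single W]
    · exact hP.idem _ _
    · intro Z hZ hne
      have hZ' := (Finset.mem_filter.1 hZ).2
      exact hP.orth Z W hne (hZ'.trans hW.symm) _
        (hW ▸ h₂.map_mem _ _ (corr_right_mem (hbc Z hZ').1))
    · intro h
      exact (h (by simp [hW])).elim

/-- This is single-valuedness. If b maps to zero locally, it is locally some `d₁ b'`. With c' a
partner of b', induction makes c locally equal to `d₂ c'`, whence `d₂ c` is locally zero. -/
theorem corr_eq_zero [Finite F] (hP : FlatProjections rk G P) (h₁ : LocallyExact rk G P m d₁)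
    (h₂ : LocallyExact rk G P m d₂) {r : ℕ} (hr : r ≤ m) {y : B}
    (h : corr rk G P d₁ d₂ r 0 y) : y = 0 := by
  induction r generalizing y with
  | zero => exact h.2.symm
  | succ r ih =>
    refine hP.eq_zero (r + 1) y h.2.1 fun Z hZ => ?_
    obtain ⟨b, c, hbc, hb, hc⟩ := h.2.2 Z hZ
    rw [map_zero] at hb
    rw [hc]
    cases r with
    | zero =>
      have hb0 : b = 0 := by
        rw [← hP.degree_zero Z b hbc.1]
        exact h₁.exact_zero Z (by omega) (by omega) b hbc.1 hb.symm
      rw [← hbc.2, hb0, map_zero, map_zero]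
    | succ r =>
      obtain ⟨b', hb', hbb⟩ :=
        h₁.exact_succ Z (by omega) (by omega) r b (corr_left_mem hbc) hb.symm
      obtain ⟨c', hc'⟩ := corr_exists hP h₁ h₂ (by omega) hb'
      have h3 := corr_proj hP (corr_sub hbc (corr_d h₁ h₂ hc')) Z
      rw [map_sub, hbb, sub_self] at h3
      have h4 := ih (by omega) h3
      rw [map_sub, sub_eq_zero] at h4
      rw [← h₂.compat, h4, h₂.compat, h₂.sq_zero, map_zero]

theorem corr_left_unique [Finite F] (hP : FlatProjections rk G P)
    (h₁ : LocallyExact rk G P m d₁) (h₂ : LocallyExact rk G P m d₂) {r : ℕ} (hr : r ≤ m)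
    {x x' y : B} (h : corr rk G P d₁ d₂ r x y) (h' : corr rk G P d₁ d₂ r x' y) : x = x' := by
  have := corr_symm (corr_sub h h')
  rw [sub_self] at this
  exact sub_eq_zero.1 (corr_eq_zero hP h₂ h₁ hr this)

/-- Exactness in positive degree transfers between locally exact differentials. -/
theorem exact_succ_transfer [Finite F] (hP : FlatProjections rk G P) {r : ℕ}
    (h₁ : LocallyExact rk G P (r + 2) d₁) (h₂ : LocallyExact rk G P (r + 2) d₂)
    (hex : ∀ x ∈ G (r + 1), d₂ x = 0 → ∃ y ∈ G r, x = d₂ y)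
    {x : B} (hx : x ∈ G (r + 1)) (hdx : d₁ x = 0) : ∃ y ∈ G r, x = d₁ y := by
  obtain ⟨x', hx'⟩ := corr_exists hP h₁ h₂ (by omega) hx
  have h := corr_d h₁ h₂ hx'
  rw [hdx] at h
  -- Uniqueness is needed in degree r + 2, where `d₁ x` lives. This is the source of the bound p + 1
  -- on the ranks.
  obtain ⟨c, hc, rfl⟩ := hex x' (corr_right_mem hx') (corr_eq_zero hP h₁ h₂ le_rfl h)
  obtain ⟨b, hb⟩ := corr_exists hP h₂ h₁ (by omega) hc
  exact ⟨b, corr_right_mem hb,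
    corr_left_unique hP h₁ h₂ (by omega) hx' (corr_d h₁ h₂ (corr_symm hb))⟩

/-- Exactness in degree zero transfers between locally exact differentials. -/
theorem exact_zero_transfer [Finite F] (hP : FlatProjections rk G P)
    (h₁ : LocallyExact rk G P 1 d₁) (h₂ : LocallyExact rk G P 1 d₂)
    (hex : ∀ x ∈ G 0, d₂ x = 0 → x = 0) {x : B} (hx : x ∈ G 0) (hdx : d₁ x = 0) : x = 0 := by
  have h : corr rk G P d₁ d₂ 0 x x := ⟨hx, rfl⟩
  have h' := corr_d h₁ h₂ h
  rw [hdx] at h'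
  exact hex x hx (corr_eq_zero hP h₁ h₂ le_rfl h')

end Transfer

/-! ### Connected components of a matroid -/

section Components
variable {α : Type*} [Finite α] {M : Matroid α}

/-- Lying in a common circuit is transitive. -/
theorem exists_isCircuit_of_common {C₁ C₂ : Set α} {e f g : α} (h₁ : M.IsCircuit C₁)
    (h₂ : M.IsCircuit C₂) (he : e ∈ C₁) (hf₁ : f ∈ C₁) (hf₂ : f ∈ C₂) (hg : g ∈ C₂) :
    ∃ C, M.IsCircuit C ∧ C ⊆ C₁ ∪ C₂ ∧ e ∈ C ∧ g ∈ C := by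
  induction hn : (C₁ ∪ C₂).ncard using Nat.strong_induction_on generalizing C₁ C₂ f with
  | _ n ih =>
    by_cases he₂ : e ∈ C₂
    · exact ⟨C₂, h₂, Set.subset_union_right, he₂, hg⟩
    by_cases hg₁ : g ∈ C₁
    · exact ⟨C₁, h₁, Set.subset_union_left, he, hg₁⟩
    -- Eliminate f while keeping e. If g is lost, eliminate some h ∈ C₃ \ C₁ from C₂ and C₃ while
    -- keeping g. The resulting C₄ meets C₁, and C₁ ∪ C₄ misses h, so induction on the size of the
    -- union applies.
    obtain ⟨C₃, h3sub, h₃, he₃⟩ := h₁.strong_elimination h₂ hf₁ hf₂ he he₂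
    by_cases hg₃ : g ∈ C₃
    · exact ⟨C₃, h₃, h3sub.trans Set.sdiff_subset, he₃, hg₃⟩
    have hn3 : ¬ C₃ ⊆ C₁ := fun hs => by
      have := h₃.eq_of_subset_isCircuit h₁ hs
      exact (h3sub (this ▸ hf₁)).2 rfl
    obtain ⟨h, hh₃, hh₁⟩ := Set.not_subset.1 hn3
    have hh₂ : h ∈ C₂ := (h3sub hh₃).1.resolve_left hh₁
    obtain ⟨C₄, h4sub, h₄, hg₄⟩ := h₂.strong_elimination h₃ hh₂ hh₃ hg hg₃
    have hn4 : ¬ C₄ ⊆ C₂ := fun hs => by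
      have := h₄.eq_of_subset_isCircuit h₂ hs
      exact (h4sub (this ▸ hh₂)).2 rfl
    obtain ⟨q, hq₄, hq₂⟩ := Set.not_subset.1 hn4
    have hq₁ : q ∈ C₁ :=
      (h3sub ((h4sub hq₄).1.resolve_left hq₂)).1.resolve_right hq₂
    have hsub : C₁ ∪ C₄ ⊆ (C₁ ∪ C₂) \ {h} := by
      rintro x (hx | hx)
      · exact ⟨Or.inl hx, fun hxh => hh₁ (hxh ▸ hx)⟩
      · refine ⟨?_, (h4sub hx).2⟩
        rcases (h4sub hx).1 with h' | h'
        · exact Or.inr h'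
        · exact (h3sub h').1
    have hlt : (C₁ ∪ C₄).ncard < n := by
      rw [← hn]
      exact Set.ncard_lt_ncard (hsub.trans_ssubset
        (Set.sdiff_singleton_ssubset.2 (Or.inr hh₂))) (Set.toFinite _)
    obtain ⟨C, hC, hCs, hCe, hCg⟩ := ih _ hlt h₁ h₄ he hq₁ hq₄ hg₄ rfl
    exact ⟨C, hC, hCs.trans (hsub.trans Set.sdiff_subset), hCe, hCg⟩

/-- A nonempty flat of a loopless matroid contains a flat that is a connected component of it. -/
theorem exists_component (hE : M.E = Set.univ) (hloop : ∀ i, M.Indep {i}) {Z : Set α}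
    (hZ : M.IsFlat Z) (hne : Z.Nonempty) :
    ∃ X ⊆ Z, M.IsFlat X ∧ IsConnected (M.restrict X) ∧
      ∀ C ⊆ Z, M.IsCircuit C → C ⊆ X ∨ Disjoint C X := by
  obtain ⟨e, he⟩ := hne
  -- The component of e in Z. The clause `f = e` covers the case where no circuit inside Z contains
  -- e.
  set X : Set α := {f | f = e ∨ ∃ C ⊆ Z, M.IsCircuit C ∧ e ∈ C ∧ f ∈ C} with hX
  have hXZ : X ⊆ Z := by
    rintro f (rfl | ⟨C, hC, -, -, hf⟩)
    exacts [he, hC hf]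
  have hclosed : ∀ C ⊆ Z, M.IsCircuit C → ∀ f ∈ C, f ∈ X → C ⊆ X := by
    intro C hCZ hC f hfC hfX g hg
    rcases hfX with rfl | ⟨C', hC'Z, hC', he', hf'⟩
    · exact Or.inr ⟨C, hCZ, hC, hfC, hg⟩
    · obtain ⟨D, hD, hDs, hDe, hDg⟩ := exists_isCircuit_of_common hC' hC he' hf' hfC hg
      exact Or.inr ⟨D, hDs.trans (Set.union_subset hC'Z hCZ), hD, hDe, hDg⟩
  refine ⟨X, hXZ, ?_, ⟨⟨e, Or.inl rfl⟩, ?_⟩, ?_⟩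
  · rw [Matroid.isFlat_iff_closure_eq]
    refine subset_antisymm (fun x hx => ?_) (M.subset_closure X (by simp [hE]))
    by_contra hxX
    obtain ⟨C, hCsub, hC, hxC⟩ := Matroid.exists_isCircuit_of_mem_closure hx hxX
    have hCZ : C ⊆ Z := hCsub.trans (Set.insert_subset
      (hZ.closure ▸ M.closure_subset_closure hXZ hx) hXZ)
    -- As x is not a loop, C meets X, so C lies in X and contains x, a contradiction.
    have : ¬ C ⊆ {x} := fun hs => hC.not_indep ((hloop x).subset hs)
    obtain ⟨y, hy, hyx⟩ := Set.not_subset.1 this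
    exact hxX (hclosed C hCZ hC y hy ((hCsub hy).resolve_left hyx) hxC)
  · intro f hf g hg hfg
    rw [Matroid.restrict_ground_eq] at hf hg
    suffices ∃ C ⊆ Z, M.IsCircuit C ∧ f ∈ C ∧ g ∈ C by
      obtain ⟨C, hCZ, hC, hfC, hgC⟩ := this
      exact ⟨C, hC.isCircuit_restrict_of_subset (hclosed C hCZ hC f hfC hf), hfC, hgC⟩
    rcases hf with rfl | ⟨C₁, h₁Z, h₁, he₁, hf₁⟩
    · rcases hg with rfl | ⟨C₂, h₂Z, h₂, he₂, hg₂⟩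
      · exact absurd rfl hfg
      · exact ⟨C₂, h₂Z, h₂, he₂, hg₂⟩
    · rcases hg with rfl | ⟨C₂, h₂Z, h₂, he₂, hg₂⟩
      · exact ⟨C₁, h₁Z, h₁, hf₁, he₁⟩
      · obtain ⟨D, hD, hDs, hDf, hDg⟩ := exists_isCircuit_of_common h₁ h₂ hf₁ he₁ he₂ hg₂
        exact ⟨D, hDs.trans (Set.union_subset h₁Z h₂Z), hD, hDf, hDg⟩
  · intro C hCZ hC
    by_cases h : Disjoint C X
    · exact Or.inr h
    · obtain ⟨f, hfC, hfX⟩ := Set.not_disjoint_iff.1 h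
      exact Or.inl (hclosed C hCZ hC f hfC hfX)

end Components

/-! ### Projections and contractions of the exterior algebra -/

section Exterior
variable {k : Type*} [Field k] {n : ℕ}

/-- The product of the basis vectors indexed by a list. -/
def extList (k : Type*) [Field k] {n : ℕ} (l : List (Fin n)) : Ext k n :=
  (l.map (extE k)).prod

@[simp] theorem extList_nil : extList k ([] : List (Fin n)) = 1 := rfl

@[simp] theorem extList_cons (a : Fin n) (l : List (Fin n)) :
    extList k (a :: l) = extE k a * extList k l := by
  simp [extList]

/-- The linear form summing the coordinates indexed by `X`. -/
def coordForm (k : Type*) [Field k] {n : ℕ} (X : Finset (Fin n)) :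
    Module.Dual k (Fin n → k) :=
  ∑ i ∈ X, LinearMap.proj i

theorem coordForm_single (X : Finset (Fin n)) (i : Fin n) :
    coordForm k X (Pi.single i 1) = if i ∈ X then 1 else 0 := by
  simp [coordForm, LinearMap.sum_apply, Pi.single_apply]

/-- Contraction of the exterior algebra with `coordForm k X`. -/
def extContract (k : Type*) [Field k] {n : ℕ} (X : Finset (Fin n)) : Ext k n →ₗ[k] Ext k n :=
  CliffordAlgebra.contractLeft (coordForm k X)

theorem extBoundary_eq : extBoundary k n = extContract k Finset.univ := rfl

theorem extContract_extE_mul (X : Finset (Fin n)) (i : Fin n) (x : Ext k n) :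
    extContract k X (extE k i * x) = (if i ∈ X then x else 0) - extE k i * extContract k X x := by
  have h := CliffordAlgebra.contractLeft_ι_mul (Q := (0 : QuadraticForm k (Fin n → k)))
    (coordForm k X) (Pi.single i 1) x
  rw [coordForm_single] at h
  refine h.trans ?_
  rw [ite_smul, one_smul, zero_smul]
  rfl

theorem extContract_one (X : Finset (Fin n)) : extContract k X (1 : Ext k n) = 0 :=
  CliffordAlgebra.contractLeft_one (Q := 0) _

theorem extContract_comm (X Y : Finset (Fin n)) (x : Ext k n) :
    extContract k X (extContract k Y x) = -extContract k Y (extContract k X x) :=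
  CliffordAlgebra.contractLeft_comm _ _ _

theorem extContract_self (X : Finset (Fin n)) (x : Ext k n) :
    extContract k X (extContract k X x) = 0 :=
  CliffordAlgebra.contractLeft_contractLeft _ _

theorem extContract_mul (X : Finset (Fin n)) (x y : Ext k n) :
    extContract k X (x * y) =
      extContract k X x * y + CliffordAlgebra.involute x * extContract k X y := by
  induction x using CliffordAlgebra.induction generalizing y with
  | algebraMap r =>
    rw [extContract, CliffordAlgebra.contractLeft_algebraMap_mul,
      CliffordAlgebra.contractLeft_algebraMap, zero_mul, zero_add, AlgHom.commutes]
  | ι v =>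
    rw [extContract, CliffordAlgebra.contractLeft_ι_mul, CliffordAlgebra.contractLeft_ι,
      CliffordAlgebra.involute_ι, Algebra.smul_def]
    simp [sub_eq_add_neg]
  | mul a b ha hb =>
    rw [mul_assoc, ha, hb, ha b, map_mul]
    noncomm_ring
  | add a b ha hb =>
    rw [add_mul, map_add, ha, hb, map_add, map_add]
    noncomm_ring

theorem extContract_involute (X : Finset (Fin n)) (x : Ext k n) :
    extContract k X (CliffordAlgebra.involute x) =
      -CliffordAlgebra.involute (extContract k X x) := by
  induction x using CliffordAlgebra.induction with
  | algebraMap r =>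
    rw [AlgHom.commutes, extContract, CliffordAlgebra.contractLeft_algebraMap, map_zero, neg_zero]
  | ι v =>
    rw [CliffordAlgebra.involute_ι, map_neg, extContract, CliffordAlgebra.contractLeft_ι,
      AlgHom.commutes]
  | mul a b ha hb =>
    rw [map_mul, extContract_mul, ha, hb, extContract_mul, map_add, map_mul, map_mul]
    noncomm_ring
  | add a b ha hb => rw [map_add, map_add, ha, hb, map_add, map_add, neg_add]

/-- The coordinate projection of `kⁿ` that kills the coordinates outside `Z`. -/
def coordProj (k : Type*) [Field k] {n : ℕ} (Z : Finset (Fin n)) :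
    (Fin n → k) →ₗ[k] (Fin n → k) :=
  LinearMap.pi fun i => if i ∈ Z then LinearMap.proj i else 0

theorem coordProj_single (Z : Finset (Fin n)) (i : Fin n) :
    coordProj k Z (Pi.single i 1) = if i ∈ Z then Pi.single i 1 else 0 := by
  ext j
  by_cases hij : j = i
  · subst hij
    by_cases hj : j ∈ Z <;> simp [coordProj, hj]
  · by_cases hj : j ∈ Z <;> by_cases hi : i ∈ Z <;> simp [coordProj, hij, hi, hj]

/-- The algebra endomorphism of `E` that kills `eᵢ` for `i ∉ Z`. -/
def extProj (k : Type*) [Field k] {n : ℕ} (Z : Finset (Fin n)) : Ext k n →ₐ[k] Ext k n :=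
  ExteriorAlgebra.map (coordProj k Z)

theorem extProj_extE (Z : Finset (Fin n)) (i : Fin n) :
    extProj k Z (extE k i) = if i ∈ Z then extE k i else 0 := by
  rw [extProj, extE, ExteriorAlgebra.map_apply_ι, coordProj_single]
  split_ifs <;> simp

theorem extProj_extList (Z : Finset (Fin n)) (l : List (Fin n)) :
    extProj k Z (extList k l) = if ∀ i ∈ l, i ∈ Z then extList k l else 0 := by
  induction l with
  | nil => simp
  | cons a l ih =>
    rw [extList_cons, map_mul, ih, extProj_extE]
    by_cases ha : a ∈ Z <;> by_cases hl : ∀ i ∈ l, i ∈ Z <;> simp [ha, hl]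

theorem extProj_extContract_of_subset {Z X : Finset (Fin n)} {l : List (Fin n)}
    (h : ∀ i ∈ l, i ∈ Z) :
    extProj k Z (extContract k X (extList k l)) = extContract k X (extList k l) := by
  induction l with
  | nil => simp [extContract_one]
  | cons a l ih =>
    have hl : ∀ i ∈ l, i ∈ Z := fun i hi => h i (List.mem_cons_of_mem _ hi)
    have ha : a ∈ Z := h a List.mem_cons_self
    rw [extList_cons, extContract_extE_mul, map_sub, map_mul, ih hl, extProj_extE, if_pos ha]
    congr 1
    split_ifs
    · rw [extProj_extList, if_pos hl]
    · simp

/-- Contraction deletes one factor from each term, so every term keeps a factor outside Z. -/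
theorem extProj_extContract_eq_zero {Z X : Finset (Fin n)} {l : List (Fin n)} {i j : Fin n}
    (hij : i ≠ j) (hi : i ∈ l) (hj : j ∈ l) (hiZ : i ∉ Z) (hjZ : j ∉ Z) :
    extProj k Z (extContract k X (extList k l)) = 0 := by
  have hz : ∀ (m : List (Fin n)) (a : Fin n), a ∈ m → a ∉ Z → extProj k Z (extList k m) = 0 := by
    intro m a ham haZ
    rw [extProj_extList, if_neg fun h => haZ (h a ham)]
  induction l with
  | nil => simp at hi
  | cons a l ih =>
    have hl : extProj k Z (extList k l) = 0 := by
      rcases List.mem_cons.1 hi with rfl | hi'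
      · exact hz l j ((List.mem_cons.1 hj).resolve_left hij.symm) hjZ
      · exact hz l i hi' hiZ
    have h0 : extProj k Z (if a ∈ X then extList k l else 0) = 0 := by
      split_ifs
      · exact hl
      · simp
    rw [extList_cons, extContract_extE_mul, map_sub, map_mul, extProj_extE, h0]
    by_cases ha : a ∈ Z
    · have hi' : i ∈ l := (List.mem_cons.1 hi).resolve_left fun h => hiZ (h ▸ ha)
      have hj' : j ∈ l := (List.mem_cons.1 hj).resolve_left fun h => hjZ (h ▸ ha)
      rw [ih hi' hj', mul_zero, sub_zero]
    · rw [if_neg ha, zero_mul, sub_zero]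

theorem extContract_extList_congr {X Y : Finset (Fin n)} {l : List (Fin n)}
    (h : ∀ i ∈ l, (i ∈ X ↔ i ∈ Y)) :
    extContract k X (extList k l) = extContract k Y (extList k l) := by
  induction l with
  | nil => simp [extContract_one]
  | cons a l ih =>
    rw [extList_cons, extContract_extE_mul, extContract_extE_mul,
      ih fun i hi => h i (List.mem_cons_of_mem _ hi)]
    simp only [h a List.mem_cons_self]

theorem extContract_empty (x : Ext k n) : extContract k ∅ x = 0 := by
  simp [extContract, coordForm]

/-! ### Sign rules and vanishing of exterior monomials -/

theorem extE_mul_self (i : Fin n) : extE k i * extE k i = 0 :=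
  ExteriorAlgebra.ι_sq_zero _

theorem extE_mul_swap (i j : Fin n) : extE k i * extE k j = -(extE k j * extE k i) :=
  eq_neg_of_add_eq_zero_left (ExteriorAlgebra.ι_add_mul_swap _ _)

theorem extList_perm {l l' : List (Fin n)} (h : l.Perm l') :
    extList k l = extList k l' ∨ extList k l = -extList k l' := by
  induction h with
  | nil => exact Or.inl rfl
  | cons a _ ih =>
    rcases ih with ih | ih
    · exact Or.inl (by rw [extList_cons, ih, extList_cons])
    · exact Or.inr (by rw [extList_cons, ih, extList_cons, mul_neg])
  | swap a b l =>
    refine Or.inr ?_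
    rw [extList_cons, extList_cons, extList_cons, extList_cons, ← mul_assoc, ← mul_assoc,
      extE_mul_swap, neg_mul]
  | trans _ _ ih₁ ih₂ =>
    rcases ih₁ with h₁ | h₁ <;> rcases ih₂ with h₂ | h₂ <;> simp [h₁, h₂]

theorem extList_append (l m : List (Fin n)) :
    extList k (l ++ m) = extList k l * extList k m := by
  simp [extList]

theorem extList_eq_zero_of_not_nodup {l : List (Fin n)} (h : ¬ l.Nodup) : extList k l = 0 := by
  obtain ⟨a, ha⟩ : ∃ a, List.Duplicate a l := by
    by_contra! hc
    exact h (List.nodup_iff_forall_not_duplicate.2 hc)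
  have hc : 2 ≤ l.count a := List.duplicate_iff_two_le_count.1 ha
  have h1 : a ∈ l := List.count_pos_iff.1 (by omega)
  have h2 : a ∈ l.erase a := List.count_pos_iff.1 (by rw [List.count_erase_self]; omega)
  have hp : l.Perm (a :: a :: (l.erase a).erase a) :=
    (List.perm_cons_erase h1).trans ((List.perm_cons_erase h2).cons a)
  have h0 : extList k (a :: a :: (l.erase a).erase a) = 0 := by
    rw [extList_cons, extList_cons, ← mul_assoc, extE_mul_self, zero_mul]
  rcases extList_perm (k := k) hp with h | h <;> simp [h, h0]

theorem extE_mul_extList_of_mem {i : Fin n} {l : List (Fin n)} (hi : i ∈ l) :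
    extE k i * extList k l = 0 := by
  rw [← extList_cons]
  exact extList_eq_zero_of_not_nodup fun h => (List.nodup_cons.1 h).1 hi

end Exterior

/-! ### Operators on the Orlik-Solomon algebra -/

section OrlikSolomon
variable {k : Type*} [Field k] {n : ℕ} {M : Matroid (Fin n)}

theorem osMk_eq_zero_iff {x : Ext k n} : osMk k M x = 0 ↔ x ∈ osIdeal k M := by
  rw [TwoSidedIdeal.mem_iff, ← RingCon.eq]
  exact Iff.rfl

theorem osMk_surjective : Function.Surjective (osMk k M) := by
  intro a
  obtain ⟨x, rfl⟩ := Quotient.exists_rep a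
  exact ⟨x, rfl⟩

theorem extMonomial_eq (C : Finset (Fin n)) : extMonomial k C = extList k C.sort := rfl

/-- The generators are homogeneous, so the grade involution acts on them by a sign. The ideal must
be stable under it because it enters the Leibniz rule for contractions. -/
theorem involute_extBoundary_extMonomial (C : Finset (Fin n)) :
    CliffordAlgebra.involute (extBoundary k n (extMonomial k C)) =
        extBoundary k n (extMonomial k C) ∨
      CliffordAlgebra.involute (extBoundary k n (extMonomial k C)) =
        -extBoundary k n (extMonomial k C) := by
  have h : ∀ l : List (Fin n), CliffordAlgebra.involute (extList k l) = extList k l ∨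
      CliffordAlgebra.involute (extList k l) = -extList k l := by
    intro l
    induction l with
    | nil => exact Or.inl (map_one _)
    | cons a l ih =>
      have ha : CliffordAlgebra.involute (extE k a) = -extE k a :=
        CliffordAlgebra.involute_ι _
      rw [extList_cons, map_mul, ha]
      rcases ih with ih | ih <;> simp [ih]
  have hinv : ∀ x : Ext k n, CliffordAlgebra.involute (extContract k Finset.univ x) =
      -extContract k Finset.univ (CliffordAlgebra.involute x) := fun x => by
    rw [extContract_involute, neg_neg]
  rw [extBoundary_eq, extMonomial_eq, hinv]
  rcases h C.sort with h | h <;> rw [h]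
  · exact Or.inr rfl
  · exact Or.inl (by rw [map_neg, neg_neg])

theorem involute_mem_osIdeal {x : Ext k n} (hx : x ∈ osIdeal k M) :
    CliffordAlgebra.involute x ∈ osIdeal k M := by
  induction hx using TwoSidedIdeal.span_induction with
  | mem x h =>
    obtain ⟨C, hC, rfl⟩ := h
    have hmem : extBoundary k n (extMonomial k C) ∈ osIdeal k M :=
      TwoSidedIdeal.subset_span ⟨C, hC, rfl⟩
    rcases involute_extBoundary_extMonomial (k := k) C with h | h <;> rw [h]
    exacts [hmem, neg_mem hmem]
  | zero => rw [map_zero]; exact zero_mem _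
  | add x y _ _ hx hy => rw [map_add]; exact add_mem hx hy
  | neg x _ hx => rw [map_neg]; exact neg_mem hx
  | left_absorb a x _ hx => rw [map_mul]; exact TwoSidedIdeal.mul_mem_left _ _ _ hx
  | right_absorb a x _ hx => rw [map_mul]; exact TwoSidedIdeal.mul_mem_right _ _ _ hx

/-- A circuit not contained in a flat has two elements outside of it. -/
theorem exists_two_notMem_flat {Z C : Set (Fin n)} (hZ : M.IsFlat Z) (hC : M.IsCircuit C)
    (h : ¬ C ⊆ Z) : ∃ i ∈ C, ∃ j ∈ C, i ≠ j ∧ i ∉ Z ∧ j ∉ Z := by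
  obtain ⟨i, hi, hiZ⟩ := Set.not_subset.1 h
  by_contra! hc
  have hsub : C \ {i} ⊆ Z := fun j hj => by
    by_contra hjZ
    exact hjZ (hc i hi j hj.1 (fun hij => hj.2 hij.symm) hiZ)
  exact hiZ (hZ.closure ▸ M.closure_subset_closure hsub
    (hC.mem_closure_sdiff_singleton_of_mem hi))

/-- A circuit inside Z keeps its generator. Any other circuit has two elements outside the flat, so
its generator is killed. -/
theorem extProj_mem_osIdeal {Z : Finset (Fin n)} (hZ : M.IsFlat (Z : Set (Fin n)))
    {x : Ext k n} (hx : x ∈ osIdeal k M) : extProj k Z x ∈ osIdeal k M := by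
  induction hx using TwoSidedIdeal.span_induction with
  | mem x h =>
    obtain ⟨C, hC, rfl⟩ := h
    rw [extBoundary_eq, extMonomial_eq]
    by_cases hCZ : (C : Set (Fin n)) ⊆ Z
    · rw [extProj_extContract_of_subset fun i hi => hCZ (by simpa using hi)]
      exact TwoSidedIdeal.subset_span ⟨C, hC, rfl⟩
    · obtain ⟨i, hi, j, hj, hij, hiZ, hjZ⟩ := exists_two_notMem_flat hZ hC hCZ
      rw [extProj_extContract_eq_zero hij (by simpa using hi) (by simpa using hj)
        (by simpa using hiZ) (by simpa using hjZ)]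
      exact zero_mem _
  | zero => rw [map_zero]; exact zero_mem _
  | add x y _ _ hx hy => rw [map_add]; exact add_mem hx hy
  | neg x _ hx => rw [map_neg]; exact neg_mem hx
  | left_absorb a x _ hx => rw [map_mul]; exact TwoSidedIdeal.mul_mem_left _ _ _ hx
  | right_absorb a x _ hx => rw [map_mul]; exact TwoSidedIdeal.mul_mem_right _ _ _ hx

/-- Contractions anticommute. On e_C with C ⊆ Z, contraction along X is ∂ if C ⊆ X and zero if C
misses X, so ∂∂ = 0 kills the generator either way. The Leibniz rule extends this to the whole
ideal. -/
theorem extContract_extProj_mem_osIdeal {Z X : Finset (Fin n)}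
    (hZ : M.IsFlat (Z : Set (Fin n)))
    (hX : ∀ C : Set (Fin n), C ⊆ Z → M.IsCircuit C → C ⊆ X ∨ Disjoint C (X : Set (Fin n)))
    {x : Ext k n} (hx : x ∈ osIdeal k M) :
    extContract k X (extProj k Z x) ∈ osIdeal k M := by
  induction hx using TwoSidedIdeal.span_induction with
  | mem x h =>
    obtain ⟨C, hC, rfl⟩ := h
    suffices extContract k X (extProj k Z (extBoundary k n (extMonomial k C))) = 0 from
      this ▸ zero_mem _
    rw [extBoundary_eq, extMonomial_eq]
    by_cases hCZ : (C : Set (Fin n)) ⊆ Z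
    · rw [extProj_extContract_of_subset fun i hi => hCZ (by simpa using hi), extContract_comm]
      rcases hX C hCZ hC with h | h
      · rw [extContract_extList_congr (X := X) (Y := Finset.univ), extContract_self, neg_zero]
        intro i hi
        exact iff_of_true (h (by simpa using hi)) (Finset.mem_univ _)
      · rw [extContract_extList_congr (X := X) (Y := ∅), extContract_empty, map_zero, neg_zero]
        intro i hi
        exact iff_of_false (fun hiX => Set.disjoint_left.1 h (by simpa using hi) hiX)
          (Finset.notMem_empty _)
    · obtain ⟨i, hi, j, hj, hij, hiZ, hjZ⟩ := exists_two_notMem_flat hZ hC hCZ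
      rw [extProj_extContract_eq_zero hij (by simpa using hi) (by simpa using hj)
        (by simpa using hiZ) (by simpa using hjZ), map_zero]
  | zero => rw [map_zero, map_zero]; exact zero_mem _
  | add x y _ _ hx hy => rw [map_add, map_add]; exact add_mem hx hy
  | neg x _ hx => rw [map_neg, map_neg]; exact neg_mem hx
  | left_absorb a x h hx =>
    rw [map_mul, extContract_mul]
    exact add_mem (TwoSidedIdeal.mul_mem_left _ _ _ (extProj_mem_osIdeal hZ h))
      (TwoSidedIdeal.mul_mem_left _ _ _ hx)
  | right_absorb a x h hx =>
    rw [map_mul, extContract_mul]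
    exact add_mem (TwoSidedIdeal.mul_mem_right _ _ _ hx)
      (TwoSidedIdeal.mul_mem_right _ _ _ (involute_mem_osIdeal (extProj_mem_osIdeal hZ h)))

/-- Contractions are not multiplicative, so only a linear descent is available. It is built from a
linear section of the quotient map. -/
theorem exists_descend (f : Ext k n →ₗ[k] Ext k n)
    (hf : ∀ x ∈ osIdeal k M, f x ∈ osIdeal k M) :
    ∃ g : OSAlgebra k M →ₗ[k] OSAlgebra k M, ∀ x, g (osMk k M x) = osMk k M (f x) := by
  obtain ⟨s, hs⟩ := (osMk k M).toLinearMap.exists_rightInverse_of_surjective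
    (LinearMap.range_eq_top.2 osMk_surjective)
  refine ⟨(osMk k M).toLinearMap ∘ₗ f ∘ₗ s, fun x => ?_⟩
  have h : osMk k M (s (osMk k M x)) = osMk k M x := LinearMap.congr_fun hs (osMk k M x)
  have h' : s (osMk k M x) - x ∈ osIdeal k M := by
    rw [← osMk_eq_zero_iff, map_sub, h, sub_self]
  have := osMk_eq_zero_iff.2 (hf _ h')
  rw [map_sub, map_sub, sub_eq_zero] at this
  exact this

/-- The image in `A(M)` of the product of the basis vectors indexed by a list. -/
def osList (k : Type*) [Field k] {n : ℕ} (M : Matroid (Fin n)) (l : List (Fin n)) :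
    OSAlgebra k M :=
  osMk k M (extList k l)

/-- Left multiplication by `eᵢ` on `A(M)`. -/
def osLeft (k : Type*) [Field k] {n : ℕ} (M : Matroid (Fin n)) (i : Fin n) :
    OSAlgebra k M →ₗ[k] OSAlgebra k M :=
  LinearMap.mulLeft k (osMk k M (extE k i))

theorem osLeft_osMk (i : Fin n) (x : Ext k n) :
    osLeft k M i (osMk k M x) = osMk k M (extE k i * x) := by
  simp [osLeft]

theorem osList_cons (i : Fin n) (l : List (Fin n)) :
    osList k M (i :: l) = osLeft k M i (osList k M l) := by
  rw [osList, osList, osLeft_osMk, extList_cons]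

theorem osLeft_swap (i j : Fin n) (x : OSAlgebra k M) :
    osLeft k M i (osLeft k M j x) = -osLeft k M j (osLeft k M i x) := by
  obtain ⟨x, rfl⟩ := osMk_surjective x
  simp only [osLeft_osMk]
  rw [← mul_assoc, extE_mul_swap, neg_mul, map_neg, mul_assoc]

theorem osLeft_self (i : Fin n) (x : OSAlgebra k M) :
    osLeft k M i (osLeft k M i x) = 0 := by
  obtain ⟨x, rfl⟩ := osMk_surjective x
  simp only [osLeft_osMk]
  rw [← mul_assoc, extE_mul_self, zero_mul, map_zero]

/-! ### Monomials spanning the graded pieces -/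

open scoped Pointwise in
theorem osDegree_eq_span (p : ℕ) :
    osDegree k M p = Submodule.span k (osList k M '' {l | l.length = p}) := by
  have hr : LinearMap.range (ExteriorAlgebra.ι k (M := Fin n → k)) =
      Submodule.span k (Set.range (extE k)) := by
    rw [LinearMap.range_eq_map, ← (Pi.basisFun k (Fin n)).span_eq, Submodule.map_span,
      ← Set.range_comp]
    congr 2
    ext i
    simp [extE]
  have hs : (Set.range (extE k (n := n))) ^ p = extList k '' {l | l.length = p} := by
    induction p with
    | zero =>
      ext x
      simp only [pow_zero, Set.mem_one, Set.mem_image, Set.mem_ofPred_eq, List.length_eq_zero_iff,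
        exists_eq_left, extList_nil, eq_comm]
    | succ p ih =>
      rw [pow_succ', ih]
      ext x
      constructor
      · rintro ⟨_, ⟨i, rfl⟩, _, ⟨l, hl, rfl⟩, rfl⟩
        exact ⟨i :: l, by simpa using hl, extList_cons i l⟩
      · rintro ⟨l, hl, rfl⟩
        obtain ⟨i, m, rfl⟩ := List.exists_cons_of_length_eq_add_one hl
        exact ⟨_, ⟨i, rfl⟩, _, ⟨m, by simpa using hl, rfl⟩, (extList_cons i m).symm⟩
  rw [osDegree, ExteriorAlgebra.exteriorPower, hr, Submodule.span_pow, hs, Submodule.map_span,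
    ← Set.image_comp]
  rfl

theorem osList_mem (l : List (Fin n)) : osList k M l ∈ osDegree k M l.length := by
  rw [osDegree_eq_span]
  exact Submodule.subset_span ⟨l, rfl, rfl⟩

/-- A linear map sends `A^p` to `S` as soon as it does so on the monomials. -/
theorem map_osDegree_mem {N : Type*} [AddCommGroup N] [Module k N]
    {f : OSAlgebra k M →ₗ[k] N} {S : Submodule k N} {p : ℕ}
    (h : ∀ l : List (Fin n), l.length = p → f (osList k M l) ∈ S) {x : OSAlgebra k M}
    (hx : x ∈ osDegree k M p) : f x ∈ S := by
  rw [osDegree_eq_span] at hx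
  have hle : Submodule.span k (osList k M '' {l | l.length = p}) ≤ S.comap f := by
    rw [Submodule.span_le]
    rintro _ ⟨l, hl, rfl⟩
    exact h l hl
  exact hle hx

theorem map_osDegree_eq {N : Type*} [AddCommGroup N] [Module k N]
    {f g : OSAlgebra k M →ₗ[k] N} {p : ℕ}
    (h : ∀ l : List (Fin n), l.length = p → f (osList k M l) = g (osList k M l))
    {x : OSAlgebra k M} (hx : x ∈ osDegree k M p) : f x = g x := by
  have := map_osDegree_mem (f := f - g) (S := ⊥)
    (fun l hl => by simp [h l hl]) hx
  simpa [sub_eq_zero] using this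

theorem osLeft_mem (i : Fin n) {p : ℕ} {x : OSAlgebra k M} (hx : x ∈ osDegree k M p) :
    osLeft k M i x ∈ osDegree k M (p + 1) :=
  map_osDegree_mem (fun l hl => by
    rw [← osList_cons, ← hl]
    exact osList_mem (i :: l)) hx

/-- For i ∈ C, applying ∂ to e_i e_C = 0 gives e_C = e_i ∂e_C. -/
theorem extMonomial_mem_osIdeal {C : Finset (Fin n)} (hC : M.IsCircuit (C : Set (Fin n))) :
    extMonomial k C ∈ osIdeal k M := by
  obtain ⟨i, hi⟩ := hC.nonempty
  have h := extContract_extE_mul (k := k) Finset.univ i (extMonomial k C)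
  rw [extMonomial_eq, extE_mul_extList_of_mem (by simpa using hi), map_zero,
    if_pos (Finset.mem_univ _), eq_comm, sub_eq_zero] at h
  rw [extMonomial_eq, h]
  exact TwoSidedIdeal.mul_mem_left _ _ _ (TwoSidedIdeal.subset_span ⟨C, hC, rfl⟩)

theorem osList_eq_zero_of_circuit {C : Finset (Fin n)} (hC : M.IsCircuit (C : Set (Fin n)))
    {l : List (Fin n)} (h : ∀ i ∈ C, i ∈ l) : osList k M l = 0 := by
  have hsub : List.Subperm C.sort l :=
    (Finset.sort_nodup _ _).subperm fun i hi => h i (by simpa using hi)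
  obtain ⟨l', hl', hs⟩ := hsub
  obtain ⟨m, hm'⟩ := hs.exists_perm_append
  have hm : l.Perm (C.sort ++ m) := hm'.trans (hl'.append_right m)
  have h0 : osMk k M (extList k (C.sort ++ m)) = 0 := by
    rw [extList_append, map_mul, ← extMonomial_eq,
      osMk_eq_zero_iff.2 (extMonomial_mem_osIdeal hC), zero_mul]
  rw [osList]
  rcases extList_perm (k := k) hm with h | h <;> simp [h, h0]

/-- A monomial vanishes unless its factors are distinct and independent. -/
theorem osList_eq_zero (hE : M.E = Set.univ) {l : List (Fin n)}
    (h : ¬ (l.Nodup ∧ M.Indep {i | i ∈ l})) : osList k M l = 0 := by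
  by_cases hl : l.Nodup
  · have hd : M.Dep {i | i ∈ l} := ⟨fun hi => h ⟨hl, hi⟩, by simp [hE]⟩
    obtain ⟨C, hCl, hC⟩ := hd.exists_isCircuit_subset
    have hCf := (Set.toFinite C).coe_toFinset
    exact osList_eq_zero_of_circuit (C := (Set.toFinite C).toFinset) (by rwa [hCf])
      fun i hi => hCl (by simpa using hi)
  · rw [osList, extList_eq_zero_of_not_nodup hl, map_zero]

theorem encard_of_nodup {l : List (Fin n)} (hl : l.Nodup) :
    ({i | i ∈ l} : Set (Fin n)).encard = l.length := by
  rw [← List.toFinset_card_of_nodup hl, ← Set.encard_coe_eq_coe_finsetCard]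
  congr 1
  ext i
  simp

end OrlikSolomon

/-! ### The Orlik-Solomon algebra as a module over the flats -/

section Flats
variable {k : Type*} [Field k] {n : ℕ} {M : Matroid (Fin n)}

/-- The flats of `M`, as finite sets. -/
abbrev Flats {n : ℕ} (M : Matroid (Fin n)) : Type :=
  {Z : Finset (Fin n) // M.IsFlat (Z : Set (Fin n))}

/-- The rank of a flat. -/
def flatRank (Z : Flats M) : ℕ := (M.eRk (Z.1 : Set (Fin n))).toNat

theorem eRk_flat (Z : Flats M) : M.eRk (Z.1 : Set (Fin n)) = flatRank Z := by
  refine (ENat.natCast_toNat ?_).symm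
  exact ne_top_of_le_ne_top (by simp) (M.eRk_le_encard (Z.1 : Set (Fin n)))

/-- The projection of `A(M)` onto the subalgebra generated by the elements of a flat. -/
def osProj (k : Type*) [Field k] {n : ℕ} {M : Matroid (Fin n)} (Z : Flats M) :
    OSAlgebra k M →ₗ[k] OSAlgebra k M :=
  (exists_descend (extProj k Z.1).toLinearMap fun _ => extProj_mem_osIdeal Z.2).choose

theorem osProj_osMk (Z : Flats M) (x : Ext k n) :
    osProj k Z (osMk k M x) = osMk k M (extProj k Z.1 x) :=
  (exists_descend (extProj k Z.1).toLinearMap fun _ => extProj_mem_osIdeal Z.2).choose_spec x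

theorem osProj_osList (Z : Flats M) (l : List (Fin n)) :
    osProj k Z (osList k M l) = if ∀ i ∈ l, i ∈ Z.1 then osList k M l else 0 := by
  rw [osList, osProj_osMk, extProj_extList]
  split_ifs <;> simp

theorem osProj_comp_osLeft (Z : Flats M) (i : Fin n) :
    osProj k Z ∘ₗ osLeft k M i = if i ∈ Z.1 then osLeft k M i ∘ₗ osProj k Z else 0 := by
  ext x
  obtain ⟨x, rfl⟩ := osMk_surjective x
  rw [LinearMap.comp_apply, osLeft_osMk, osProj_osMk, map_mul, extProj_extE]
  split_ifs
  · rw [LinearMap.comp_apply, osProj_osMk, osLeft_osMk]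
  · simp

theorem extProj_extProj (Z : Finset (Fin n)) (x : Ext k n) :
    extProj k Z (extProj k Z x) = extProj k Z x := by
  have h : coordProj k Z ∘ₗ coordProj k Z = coordProj k Z := by
    ext i j
    by_cases hj : j ∈ Z <;> simp [coordProj, hj]
  rw [← AlgHom.comp_apply, extProj, ExteriorAlgebra.map_comp_map, h]

theorem osProj_comp_self (Z : Flats M) : osProj k Z ∘ₗ osProj k Z = osProj k Z := by
  ext x
  obtain ⟨x, rfl⟩ := osMk_surjective x
  rw [LinearMap.comp_apply, osProj_osMk, osProj_osMk, extProj_extProj]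

/-- An independent set of full size spans. Hence a nonzero monomial of degree r is supported in
exactly one flat of rank r, its closure. -/
theorem closure_eq_flat (Z : Flats M) {l : List (Fin n)} (hl : l.Nodup)
    (hi : M.Indep {i | i ∈ l}) (hZ : ∀ i ∈ l, i ∈ Z.1) (hr : flatRank Z = l.length) :
    M.closure {i | i ∈ l} = Z.1 := by
  rw [← Z.2.closure]
  refine Matroid.IsRkFinite.closure_eq_closure_of_subset_of_eRk_ge_eRk ?_ (fun i h => hZ i h) ?_
  · rw [← Matroid.eRk_ne_top_iff, hi.eRk_eq_encard, encard_of_nodup hl]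
    simp
  · rw [eRk_flat, hi.eRk_eq_encard, encard_of_nodup hl, hr]

theorem osProj_mem (Z : Flats M) {p : ℕ} {x : OSAlgebra k M} (hx : x ∈ osDegree k M p) :
    osProj k Z x ∈ osDegree k M p :=
  map_osDegree_mem (fun l hl => by
    rw [osProj_osList]
    split_ifs
    · exact hl ▸ osList_mem l
    · exact zero_mem _) hx

theorem osProj_comp_of_subset {Z W : Flats M} (h : W.1 ⊆ Z.1) {p : ℕ} {x : OSAlgebra k M}
    (hx : x ∈ osDegree k M p) : (osProj k W ∘ₗ osProj k Z) x = osProj k W x :=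
  map_osDegree_eq (fun l _ => by
    rw [LinearMap.comp_apply, osProj_osList]
    split_ifs with hl
    · rfl
    · rw [osProj_osList, map_zero, if_neg fun h' => hl fun i hi => h (h' i hi)]) hx

theorem osProj_comp_of_not_subset (hE : M.E = Set.univ) {Z W : Flats M} (h : ¬ W.1 ⊆ Z.1)
    {x : OSAlgebra k M} (hx : x ∈ osDegree k M (flatRank W)) :
    (osProj k W ∘ₗ osProj k Z) x = (0 : OSAlgebra k M →ₗ[k] OSAlgebra k M) x :=
  map_osDegree_eq (fun l hl => by
    rw [LinearMap.comp_apply, osProj_osList, LinearMap.zero_apply]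
    split_ifs with hZ
    · rw [osProj_osList]
      split_ifs with hW
      · refine osList_eq_zero hE fun hi => h ?_
        have hc := closure_eq_flat W hi.1 hi.2 hW hl.symm
        have hs : M.closure {i | i ∈ l} ⊆ Z.1 :=
          Z.2.closure ▸ M.closure_subset_closure (fun i hi => hZ i hi)
        rw [hc] at hs
        exact_mod_cast hs
      · rfl
    · rw [map_zero]) hx

theorem osProj_of_rank_lt (hE : M.E = Set.univ) {Z : Flats M} {p : ℕ} (h : flatRank Z < p)
    {x : OSAlgebra k M} (hx : x ∈ osDegree k M p) :
    osProj k Z x = (0 : OSAlgebra k M →ₗ[k] OSAlgebra k M) x :=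
  map_osDegree_eq (fun l hl => by
    rw [osProj_osList, LinearMap.zero_apply]
    split_ifs with hZ
    · refine osList_eq_zero hE fun hi => ?_
      have := hi.2.encard_le_eRk_of_subset (X := Z.1) (fun i hi => hZ i hi)
      rw [encard_of_nodup hi.1, eRk_flat, hl, Nat.cast_le] at this
      omega
    · rfl) hx

theorem osProj_degree_zero (Z : Flats M) {x : OSAlgebra k M} (hx : x ∈ osDegree k M 0) :
    osProj k Z x = LinearMap.id (R := k) x :=
  map_osDegree_eq (fun l hl => by
    rw [List.length_eq_zero_iff.1 hl, osProj_osList, if_pos (by simp), LinearMap.id_apply]) hx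

theorem osProj_univ {Z : Flats M} (hZ : Z.1 = Finset.univ) {p : ℕ} {x : OSAlgebra k M}
    (hx : x ∈ osDegree k M p) : osProj k Z x = LinearMap.id (R := k) x :=
  map_osDegree_eq (fun l _ => by
    rw [osProj_osList, if_pos (by simp [hZ]), LinearMap.id_apply]) hx

-- The Brieskorn decomposition: the only summand that keeps a nonzero monomial of degree p is the
-- projection to the closure of its support.
open Classical in
theorem sum_osProj (hE : M.E = Set.univ) {p : ℕ} {x : OSAlgebra k M}
    (hx : x ∈ osDegree k M p) :
    (∑ Z : Flats M with flatRank Z = p, osProj k Z) x = LinearMap.id (R := k) x :=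
  map_osDegree_eq (fun l hl => by
    by_cases hi : l.Nodup ∧ M.Indep {i | i ∈ l}
    · have hcoe := (Set.toFinite (M.closure {i | i ∈ l})).coe_toFinset
      let W : Flats M := ⟨(Set.toFinite (M.closure {i | i ∈ l})).toFinset, by
        rw [hcoe]; exact M.isFlat_closure _⟩
      have hWc : (W.1 : Set (Fin n)) = M.closure {i | i ∈ l} := hcoe
      have hlW : ∀ i ∈ l, i ∈ W.1 := fun i hil => by
        rw [← Finset.mem_coe, hWc]
        exact M.mem_closure_of_mem (by exact hil) (by simp [hE])
      have hW : flatRank W = p := by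
        have := eRk_flat W
        rw [hWc, Matroid.eRk_closure_eq, hi.2.eRk_eq_encard, encard_of_nodup hi.1, hl] at this
        exact_mod_cast this.symm
      rw [LinearMap.sum_apply, Finset.sum_eq_single W, osProj_osList, if_pos hlW,
        LinearMap.id_apply]
      · intro Z hZ hne
        rw [osProj_osList, if_neg]
        intro hlZ
        refine hne (Subtype.ext (Finset.coe_injective ?_))
        rw [hWc, closure_eq_flat Z hi.1 hi.2 hlZ (by rw [(Finset.mem_filter.1 hZ).2, hl])]
      · intro h
        exact (h (by simp [hW])).elim
    · simp [osList_eq_zero hE hi]) hx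

/-- The contraction of the subalgebra of a flat `Z` along a union `X` of components of `Z`. -/
theorem exists_homotopy (Z : Flats M) {X : Finset (Fin n)}
    (hX : ∀ C : Set (Fin n), C ⊆ Z.1 → M.IsCircuit C →
      C ⊆ X ∨ Disjoint C (X : Set (Fin n))) :
    ∃ D : OSAlgebra k M →ₗ[k] OSAlgebra k M,
      (∀ i, D ∘ₗ osLeft k M i =
        if i ∈ Z.1 then (if i ∈ X then osProj k Z else 0) - osLeft k M i ∘ₗ D else 0) ∧
      D ∘ₗ osProj k Z = D ∧
      (∀ x ∈ osDegree k M 0, D x = (0 : OSAlgebra k M →ₗ[k] OSAlgebra k M) x) ∧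
      ∀ p, ∀ x ∈ osDegree k M (p + 1), D x ∈ osDegree k M p := by
  obtain ⟨D, hD⟩ := exists_descend (M := M) (extContract k X ∘ₗ (extProj k Z.1).toLinearMap)
    fun x hx => extContract_extProj_mem_osIdeal Z.2 hX hx
  have hD' : ∀ x, D (osMk k M x) = osMk k M (extContract k X (extProj k Z.1 x)) := hD
  have hL : ∀ i, D ∘ₗ osLeft k M i =
      if i ∈ Z.1 then (if i ∈ X then osProj k Z else 0) - osLeft k M i ∘ₗ D else 0 := by
    intro i
    ext x
    obtain ⟨x, rfl⟩ := osMk_surjective x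
    rw [LinearMap.comp_apply, osLeft_osMk, hD', map_mul, extProj_extE]
    by_cases hi : i ∈ Z.1
    · rw [if_pos hi, if_pos hi, extContract_extE_mul, map_sub, LinearMap.sub_apply,
        LinearMap.comp_apply, hD', osLeft_osMk]
      congr 1
      split_ifs
      · rw [osProj_osMk]
      · simp
    · simp [hi]
  have hnil : D (osList k M []) = 0 := by
    rw [osList, hD', extList_nil, map_one, extContract_one, map_zero]
  have hcons : ∀ (i : Fin n) (l : List (Fin n)), D (osList k M (i :: l)) =
      if i ∈ Z.1 then (if i ∈ X then osProj k Z (osList k M l) else 0) -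
        osLeft k M i (D (osList k M l)) else 0 := by
    intro i l
    rw [osList_cons, ← LinearMap.comp_apply, hL]
    split_ifs <;> simp
  refine ⟨D, hL, ?_, fun x hx => map_osDegree_eq (fun l hl => ?_) hx,
    fun p x hx => map_osDegree_mem (fun l hl => ?_) hx⟩
  · ext x
    obtain ⟨x, rfl⟩ := osMk_surjective x
    rw [LinearMap.comp_apply, osProj_osMk, hD', extProj_extProj, ← hD']
  · rw [List.length_eq_zero_iff.1 hl, hnil, LinearMap.zero_apply]
  · induction p generalizing l x with
    | zero =>
      obtain ⟨i, rfl⟩ := List.length_eq_one_iff.1 hl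
      rw [hcons, hnil, map_zero, sub_zero]
      split_ifs
      · exact osProj_mem Z (osList_mem [])
      all_goals exact zero_mem _
    | succ p ih =>
      obtain ⟨i, m, rfl⟩ := List.exists_cons_of_length_eq_add_one hl
      have hm : m.length = p + 1 := by simpa using hl
      rw [hcons]
      split_ifs
      · exact sub_mem (osProj_mem Z (hm ▸ osList_mem m))
          (osLeft_mem i (ih _ (hm ▸ osList_mem m) m hm))
      · exact sub_mem (zero_mem _) (osLeft_mem i (ih _ (hm ▸ osList_mem m) m hm))
      · exact zero_mem _

end Flats

/-! ### Extension of scalars -/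

section BaseChange
open TensorProduct
variable {k : Type*} [Field k] {n : ℕ} {M : Matroid (Fin n)}

theorem baseChange_mem {K A N : Type*} [Field K] [Algebra k K] [AddCommGroup A] [Module k A]
    [AddCommGroup N] [Module k N] {p : Submodule k A} {q : Submodule k N} {f : A →ₗ[k] N}
    (h : ∀ x ∈ p, f x ∈ q) {x : K ⊗[k] A} (hx : x ∈ p.baseChange K) :
    f.baseChange K x ∈ q.baseChange K := by
  rw [Submodule.baseChange_eq_span] at hx
  have hle : Submodule.span K (p.map (TensorProduct.mk k K A 1) : Set (K ⊗[k] A)) ≤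
      (q.baseChange K).comap (f.baseChange K) := by
    rw [Submodule.span_le]
    rintro _ ⟨y, hy, rfl⟩
    exact Submodule.tmul_mem_baseChange_of_mem _ (h y hy)
  exact hle hx

theorem baseChange_congr {K A N : Type*} [Field K] [Algebra k K] [AddCommGroup A] [Module k A]
    [AddCommGroup N] [Module k N] {p : Submodule k A} {f g : A →ₗ[k] N}
    (h : ∀ x ∈ p, f x = g x) {x : K ⊗[k] A} (hx : x ∈ p.baseChange K) :
    f.baseChange K x = g.baseChange K x := by
  have := baseChange_mem (q := ⊥) (f := f - g) (fun x hx => by simp [h x hx]) hx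
  rw [Submodule.baseChange_bot, Submodule.mem_bot, LinearMap.baseChange_sub,
    LinearMap.sub_apply, sub_eq_zero] at this
  exact this

theorem baseChange_comp_apply {K A : Type*} [Field K] [Algebra k K] [AddCommGroup A]
    [Module k A] (f g : A →ₗ[k] A) (x : K ⊗[k] A) :
    f.baseChange K (g.baseChange K x) = (f ∘ₗ g).baseChange K x := by
  rw [LinearMap.baseChange_comp, LinearMap.comp_apply]

variable (K : Type*) [Field K] [Algebra k K]

/-- The graded pieces of `K ⊗ A(M)`. -/
def scDegree (k : Type*) [Field k] {n : ℕ} (M : Matroid (Fin n)) (K : Type*) [Field K]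
    [Algebra k K] (p : ℕ) : Submodule K (K ⊗[k] OSAlgebra k M) :=
  (osDegree k M p).baseChange K

/-- The projections of `K ⊗ A(M)` onto the subalgebras of flats. -/
def scProj (k : Type*) [Field k] {n : ℕ} {M : Matroid (Fin n)} (K : Type*) [Field K]
    [Algebra k K] (Z : Flats M) : K ⊗[k] OSAlgebra k M →ₗ[K] K ⊗[k] OSAlgebra k M :=
  (osProj k Z).baseChange K

/-- Left multiplication on `K ⊗ A(M)` by the vector `u ∈ Kⁿ`. -/
def scDiff (k : Type*) [Field k] {n : ℕ} (M : Matroid (Fin n)) {K : Type*} [Field K]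
    [Algebra k K] (u : Fin n → K) : K ⊗[k] OSAlgebra k M →ₗ[K] K ⊗[k] OSAlgebra k M :=
  ∑ i, u i • (osLeft k M i).baseChange K

theorem scDiff_apply (u : Fin n → K) (x : K ⊗[k] OSAlgebra k M) :
    scDiff k M u x = ∑ i, u i • (osLeft k M i).baseChange K x := by
  simp [scDiff, LinearMap.sum_apply]

theorem flatProjections (hE : M.E = Set.univ) :
    FlatProjections (flatRank (M := M)) (scDegree k M K) (scProj k K) where
  map_mem Z r x hx := baseChange_mem (fun y hy => osProj_mem Z hy) hx
  idem Z x := by rw [scProj, baseChange_comp_apply, osProj_comp_self]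
  comp_eq Z W := by
    by_cases h : W.1 ⊆ Z.1
    · left
      intro x hx
      rw [scProj, scProj, baseChange_comp_apply]
      exact baseChange_congr (fun y hy => osProj_comp_of_subset h hy) hx
    · right
      intro x hx
      rw [scProj, scProj, baseChange_comp_apply,
        baseChange_congr (fun y hy => osProj_comp_of_not_subset hE h hy) hx,
        LinearMap.baseChange_zero, LinearMap.zero_apply]
  orth Z W hne hr x hx := by
    by_cases h : W.1 ⊆ Z.1
    · exfalso
      -- Nested flats of equal rank coincide.
      have h' : M.closure W.1 = M.closure Z.1 := by
        refine Matroid.IsRkFinite.closure_eq_closure_of_subset_of_eRk_ge_eRk ?_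
          (by exact_mod_cast h) ?_
        · rw [← Matroid.eRk_ne_top_iff, eRk_flat]
          simp
        · rw [eRk_flat, eRk_flat, hr]
      rw [W.2.closure, Z.2.closure] at h'
      exact hne (Subtype.ext (Finset.coe_injective h'.symm))
    · rw [scProj, scProj, baseChange_comp_apply,
        baseChange_congr (fun y hy => osProj_comp_of_not_subset hE h hy) hx,
        LinearMap.baseChange_zero, LinearMap.zero_apply]
  eq_zero r x hx h := by
    classical
    have h1 := baseChange_congr (fun y hy => sum_osProj hE hy) hx
    have h2 : LinearMap.baseChange K (∑ Z : Flats M with flatRank Z = r, osProj k Z) =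
        ∑ Z : Flats M with flatRank Z = r, scProj k K Z :=
      map_sum (LinearMap.baseChangeHom k K (OSAlgebra k M) (OSAlgebra k M)) _ _
    rw [LinearMap.baseChange_id, LinearMap.id_apply, h2, LinearMap.sum_apply] at h1
    rw [← h1]
    exact Finset.sum_eq_zero fun Z hZ => h Z (Finset.mem_filter.1 hZ).2
  of_rank_lt Z r x hx h := by
    rw [scProj, baseChange_congr (fun y hy => osProj_of_rank_lt hE h hy) hx,
      LinearMap.baseChange_zero, LinearMap.zero_apply]
  degree_zero Z x hx := by
    rw [scProj, baseChange_congr (fun y hy => osProj_degree_zero Z hy) hx,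
      LinearMap.baseChange_id, LinearMap.id_apply]

variable {K}

theorem scDiff_mem (u : Fin n → K) {r : ℕ} {x : K ⊗[k] OSAlgebra k M}
    (hx : x ∈ scDegree k M K r) : scDiff k M u x ∈ scDegree k M K (r + 1) := by
  rw [scDiff_apply]
  exact sum_mem fun i _ => Submodule.smul_mem _ _
    (baseChange_mem (fun y hy => osLeft_mem i hy) hx)

theorem scProj_osLeft (Z : Flats M) (i : Fin n) (x : K ⊗[k] OSAlgebra k M) :
    scProj k K Z ((osLeft k M i).baseChange K x) =
      if i ∈ Z.1 then (osLeft k M i).baseChange K (scProj k K Z x) else 0 := by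
  rw [scProj, baseChange_comp_apply, osProj_comp_osLeft]
  split_ifs
  · rw [baseChange_comp_apply]
  · simp

theorem scDiff_sq (u : Fin n → K) (x : K ⊗[k] OSAlgebra k M) :
    scDiff k M u (scDiff k M u x) = 0 := by
  have h1 : ∀ i j, (osLeft k M i).baseChange K ((osLeft k M j).baseChange K x) =
      -(osLeft k M j).baseChange K ((osLeft k M i).baseChange K x) := fun i j => by
    rw [baseChange_comp_apply, baseChange_comp_apply, ← LinearMap.neg_apply,
      ← LinearMap.baseChange_neg]
    congr 2
    ext y
    exact osLeft_swap i j y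
  have h2 : ∀ i, (osLeft k M i).baseChange K ((osLeft k M i).baseChange K x) = 0 := fun i => by
    have h : osLeft k M i ∘ₗ osLeft k M i = 0 := LinearMap.ext fun y => osLeft_self i y
    rw [baseChange_comp_apply, h, LinearMap.baseChange_zero, LinearMap.zero_apply]
  simp only [scDiff_apply, map_sum, map_smul, Finset.smul_sum, smul_smul]
  rw [← Finset.sum_product']
  -- The terms (i, j) and (j, i) cancel, and the diagonal terms vanish.
  refine Finset.sum_involution (fun p _ => (p.2, p.1)) ?_ ?_ ?_ ?_
  · intro p _
    rw [h1 p.1 p.2, smul_neg, mul_comm (u p.1)]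
    exact add_neg_cancel _
  · rintro ⟨i, j⟩ _ hne heq
    obtain rfl : j = i := congrArg Prod.fst heq
    exact hne (by rw [h2, smul_zero])
  · intro p _
    exact Finset.mem_univ _
  · intro p _
    rfl

theorem scProj_scDiff_scProj (Z : Flats M) (u : Fin n → K) (x : K ⊗[k] OSAlgebra k M) :
    scProj k K Z (scDiff k M u (scProj k K Z x)) = scProj k K Z (scDiff k M u x) := by
  have hid : scProj k K Z (scProj k K Z x) = scProj k K Z x := by
    rw [scProj, baseChange_comp_apply, osProj_comp_self]
  simp only [scDiff_apply, map_sum, map_smul, scProj_osLeft, hid]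

/-- The contraction along `X` contracts the differential of a flat `Z`, up to the factor
`∑ i ∈ X, u i`. -/
theorem exists_scHomotopy (Z : Flats M) {X : Finset (Fin n)} (hXZ : X ⊆ Z.1)
    (hX : ∀ C : Set (Fin n), C ⊆ Z.1 → M.IsCircuit C →
      C ⊆ X ∨ Disjoint C (X : Set (Fin n)))
    (u : Fin n → K) {x : K ⊗[k] OSAlgebra k M} (hx : scProj k K Z (scDiff k M u x) = 0) :
    ∃ y, (∑ i ∈ X, u i) • scProj k K Z x = scProj k K Z (scDiff k M u y) ∧
      (x ∈ scDegree k M K 0 → y = 0) ∧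
      ∀ r, x ∈ scDegree k M K (r + 1) → y ∈ scDegree k M K r := by
  obtain ⟨D, hL, hD, h0, hdeg⟩ := exists_homotopy (k := k) Z hX
  refine ⟨D.baseChange K x, ?_, fun hx0 => ?_, fun r hxr => baseChange_mem (hdeg r) hxr⟩
  -- D factors through the projection to Z, so it is enough that the differential of x vanishes
  -- there.
  · have h1 : D.baseChange K (scDiff k M u x) = 0 := by
      rw [← hD, ← baseChange_comp_apply]
      exact (congrArg (D.baseChange K) hx).trans (map_zero _)
    have h2 : ∀ i, D.baseChange K ((osLeft k M i).baseChange K x) =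
        (if i ∈ X then scProj k K Z x else 0) -
          if i ∈ Z.1 then (osLeft k M i).baseChange K (D.baseChange K x) else 0 := by
      intro i
      rw [baseChange_comp_apply, hL]
      by_cases hi : i ∈ Z.1
      · rw [if_pos hi, if_pos hi, LinearMap.baseChange_sub, LinearMap.sub_apply,
          baseChange_comp_apply]
        congr 1
        split_ifs
        · rfl
        · simp
      · rw [if_neg hi, if_neg hi, if_neg fun h => hi (hXZ h)]
        simp
    -- The homotopy formula: weighting D e_i = [i ∈ X] P_Z − e_i D (for i ∈ Z) by u_i and summing,
    -- the left side vanishes by `h1`.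
    have h3 : (∑ i ∈ X, u i) • scProj k K Z x =
        ∑ i, u i • if i ∈ Z.1 then (osLeft k M i).baseChange K (D.baseChange K x) else 0 := by
      rw [scDiff_apply, map_sum] at h1
      simp only [map_smul, h2, smul_sub, Finset.sum_sub_distrib] at h1
      rw [← sub_eq_zero.1 h1, Finset.sum_smul]
      simp [smul_ite]
    have hid : scProj k K Z (scProj k K Z x) = scProj k K Z x := by
      rw [scProj, baseChange_comp_apply, osProj_comp_self]
    have h4 := congrArg (scProj k K Z) h3
    rw [map_smul, hid, map_sum] at h4
    rw [h4, scDiff_apply, map_sum]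
    refine Finset.sum_congr rfl fun i _ => ?_
    rw [map_smul, map_smul]
    congr 1
    by_cases hi : i ∈ Z.1
    · rw [if_pos hi]
    · rw [if_neg hi, scProj_osLeft, if_neg hi, map_zero]
  · rw [baseChange_congr h0 hx0, LinearMap.baseChange_zero, LinearMap.zero_apply]

/-- Multiplication by `u` is exact on the subalgebra of a flat `Z` if `u` has nonzero sum on a
union of components of `Z`. -/
theorem scDiff_exact (Z : Flats M) {X : Finset (Fin n)} (hXZ : X ⊆ Z.1)
    (hX : ∀ C : Set (Fin n), C ⊆ Z.1 → M.IsCircuit C →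
      C ⊆ X ∨ Disjoint C (X : Set (Fin n)))
    (u : Fin n → K) (hu : ∑ i ∈ X, u i ≠ 0) :
    (∀ x ∈ scDegree k M K 0, scProj k K Z (scDiff k M u x) = 0 → scProj k K Z x = 0) ∧
    ∀ r, ∀ x ∈ scDegree k M K (r + 1), scProj k K Z (scDiff k M u x) = 0 →
      ∃ y ∈ scDegree k M K r, scProj k K Z x = scProj k K Z (scDiff k M u y) := by
  constructor
  · intro x hx h
    obtain ⟨y, hy, hy0, -⟩ := exists_scHomotopy Z hXZ hX u h
    rw [hy0 hx, map_zero, map_zero] at hy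
    exact (smul_eq_zero.1 hy).resolve_left hu
  · intro r x hx h
    obtain ⟨y, hy, -, hyr⟩ := exists_scHomotopy Z hXZ hX u h
    refine ⟨(∑ i ∈ X, u i)⁻¹ • y, Submodule.smul_mem _ _ (hyr r hx), ?_⟩
    rw [map_smul, map_smul, ← hy, smul_smul, inv_mul_cancel₀ hu, one_smul]

theorem locallyExact_scDiff {m : ℕ} (u : Fin n → K)
    (h : ∀ Z : Flats M, 1 ≤ flatRank Z → flatRank Z ≤ m → ∃ X ⊆ Z.1,
      (∀ C : Set (Fin n), C ⊆ Z.1 → M.IsCircuit C → C ⊆ X ∨ Disjoint C (X : Set (Fin n))) ∧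
      ∑ i ∈ X, u i ≠ 0) :
    LocallyExact (flatRank (M := M)) (scDegree k M K) (scProj k K) m (scDiff k M u) where
  map_mem r x hx := scDiff_mem u hx
  sq_zero := scDiff_sq u
  compat Z := scProj_scDiff_scProj Z u
  exact_zero Z h₁ h₂ := by
    obtain ⟨X, hXZ, hX, hu⟩ := h Z h₁ h₂
    exact (scDiff_exact Z hXZ hX u hu).1
  exact_succ Z h₁ h₂ := by
    obtain ⟨X, hXZ, hX, hu⟩ := h Z h₁ h₂
    exact (scDiff_exact Z hXZ hX u hu).2

/-- Multiplication by a vector with nonzero coordinate sum is exact. -/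
theorem scDiff_exact_of_sum_ne_zero (hE : M.E = Set.univ) (u : Fin n → K)
    (hu : ∑ i, u i ≠ 0) :
    (∀ x ∈ scDegree k M K 0, scDiff k M u x = 0 → x = 0) ∧
    ∀ r, ∀ x ∈ scDegree k M K (r + 1), scDiff k M u x = 0 →
      ∃ y ∈ scDegree k M K r, x = scDiff k M u y := by
  -- The whole ground set is a flat whose projection is the identity, so local exactness there is
  -- global exactness.
  let Z : Flats M := ⟨Finset.univ, by
    rw [Finset.coe_univ, ← hE]
    exact M.ground_isFlat⟩
  have hid : ∀ p, ∀ x ∈ scDegree k M K p, scProj k K Z x = x := fun p x hx => by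
    rw [scProj, baseChange_congr (fun y hy => osProj_univ rfl hy) hx,
      LinearMap.baseChange_id, LinearMap.id_apply]
  have h := scDiff_exact (k := k) Z (X := Finset.univ) subset_rfl
    (fun C _ _ => Or.inl (by simp)) u hu
  refine ⟨fun x hx hdx => ?_, fun r x hx hdx => ?_⟩
  · rw [← hid 0 x hx]
    exact h.1 x hx (by rw [hdx, map_zero])
  · obtain ⟨y, hy, hxy⟩ := h.2 r x hx (by rw [hdx, map_zero])
    refine ⟨y, hy, ?_⟩
    rwa [hid _ _ hx, hid _ _ (scDiff_mem u hy)] at hxy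

end BaseChange

/-! ### Vanishing of the cohomology -/

section Vanishing
open TensorProduct
variable {k : Type*} [Field k] {n : ℕ} {M : Matroid (Fin n)}

theorem osVec_mul (v : Fin n → k) (x : OSAlgebra k M) :
    osVec k M v * x = ∑ i, v i • osLeft k M i x := by
  have hv : v = ∑ i, v i • Pi.single i (1 : k) := by
    ext j
    simp [Finset.sum_apply, Pi.single_apply]
  have h : osVec k M v = ∑ i, v i • osMk k M (extE k i) := by
    conv_lhs => rw [hv]
    simp [osVec, extE]
  rw [h, Finset.sum_mul]
  exact Finset.sum_congr rfl fun i _ => by rw [smul_mul_assoc]; rfl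

/-- Passing v through p factors of degree one costs p signs. This replaces the right multiplication
of the complex by the left multiplication used in the homotopies. -/
theorem mul_osVec (v : Fin n → k) {p : ℕ} {x : OSAlgebra k M} (hx : x ∈ osDegree k M p) :
    x * osVec k M v = (-1 : k) ^ p • (osVec k M v * x) := by
  have h := map_osDegree_eq (f := LinearMap.mulRight k (osVec k M v))
    (g := (-1 : k) ^ p • LinearMap.mulLeft k (osVec k M v)) (p := p) (fun l hl => ?_) hx
  · simpa using h
  · suffices extList k l * ExteriorAlgebra.ι k v =
        (-1 : k) ^ p • (ExteriorAlgebra.ι k v * extList k l) by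
      have := congrArg (osMk k M) this
      rw [map_mul, map_smul, map_mul] at this
      exact this
    clear hx
    subst hl
    induction l with
    | nil => simp
    | cons i l ih =>
      have hs : extE k i * ExteriorAlgebra.ι k v = -(ExteriorAlgebra.ι k v * extE k i) :=
        eq_neg_of_add_eq_zero_left (ExteriorAlgebra.ι_add_mul_swap _ _)
      rw [extList_cons, mul_assoc, ih, mul_smul_comm, ← mul_assoc, hs, List.length_cons,
        pow_succ, mul_neg_one, neg_smul, neg_mul, smul_neg, mul_assoc]

/-- Exactness of multiplication by `v` descends along an extension of scalars. -/
theorem exact_descend (K : Type*) [Field K] [Algebra k K] (v : Fin n → k) :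
    ((∀ x ∈ scDegree k M K 0, scDiff k M (fun i => algebraMap k K (v i)) x = 0 → x = 0) →
      ∀ x ∈ osDegree k M 0, osVec k M v * x = 0 → x = 0) ∧
    ∀ r, (∀ x ∈ scDegree k M K (r + 1), scDiff k M (fun i => algebraMap k K (v i)) x = 0 →
        ∃ y ∈ scDegree k M K r, x = scDiff k M (fun i => algebraMap k K (v i)) y) →
      ∀ x ∈ osDegree k M (r + 1), osVec k M v * x = 0 →
        ∃ y ∈ osDegree k M r, x = osVec k M v * y := by
  -- A k-linear retraction ρ of K onto k. As v has coordinates in k, the induced map `T` commutes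
  -- with multiplication by v, and it sends 1 ⊗ x back to x.
  obtain ⟨ρ, hρ⟩ := (Algebra.linearMap k K).exists_leftInverse_of_injective
    (LinearMap.ker_eq_bot.2 (algebraMap k K).injective)
  have hρ1 : ρ 1 = 1 := by
    have := LinearMap.congr_fun hρ 1
    simpa using this
  let T : K ⊗[k] OSAlgebra k M →ₗ[k] OSAlgebra k M :=
    (TensorProduct.lid k _).toLinearMap ∘ₗ ρ.rTensor (OSAlgebra k M)
  have hT : ∀ a x, T (a ⊗ₜ x) = ρ a • x := fun a x => by simp [T]
  have hT1 : ∀ x, T (1 ⊗ₜ x) = x := fun x => by rw [hT, hρ1, one_smul]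
  have hone : ∀ x, scDiff k M (fun i => algebraMap k K (v i)) ((1 : K) ⊗ₜ x) =
      (1 : K) ⊗ₜ (osVec k M v * x) := fun x => by
    simp only [scDiff_apply, LinearMap.baseChange_tmul, osVec_mul, TensorProduct.tmul_sum,
      TensorProduct.tmul_smul, algebraMap_smul]
  have hTd : ∀ y, T (scDiff k M (fun i => algebraMap k K (v i)) y) = osVec k M v * T y := by
    intro y
    induction y with
    | zero => simp
    | add a b ha hb => rw [map_add, map_add, ha, hb, map_add, mul_add]
    | tmul a x =>
      simp only [scDiff_apply, LinearMap.baseChange_tmul, osVec_mul, algebraMap_smul, map_sum,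
        map_smul, hT]
  have hTmem : ∀ r, ∀ y ∈ scDegree k M K r, T y ∈ osDegree k M r := by
    intro r y hy
    obtain ⟨z, rfl⟩ := Submodule.toBaseChange_surjective' K (osDegree k M r) hy
    induction z with
    | zero => simp
    | add a b ha hb =>
      rw [map_add, Submodule.coe_add, map_add]
      exact add_mem (ha (Subtype.property _)) (hb (Subtype.property _))
    | tmul a x =>
      rw [Submodule.coe_toBaseChange_tmul, hT]
      exact Submodule.smul_mem _ _ x.2
  refine ⟨fun h x hx hdx => ?_, fun r h x hx hdx => ?_⟩
  · rw [← hT1 x, h _ (Submodule.tmul_mem_baseChange_of_mem 1 hx) (by rw [hone, hdx, tmul_zero]),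
      map_zero]
  · obtain ⟨y, hy, hxy⟩ := h _ (Submodule.tmul_mem_baseChange_of_mem 1 hx)
      (by rw [hone, hdx, tmul_zero])
    exact ⟨T y, hTmem r y hy, by rw [← hTd, ← hxy, hT1]⟩

theorem cocycles_le_coboundaries_of_exact (v : Fin n → k) (p : ℕ)
    (h0 : p = 0 → ∀ x ∈ osDegree k M 0, osVec k M v * x = 0 → x = 0)
    (hs : ∀ r, p = r + 1 → ∀ x ∈ osDegree k M (r + 1), osVec k M v * x = 0 →
      ∃ y ∈ osDegree k M r, x = osVec k M v * y) :
    cocycles M v p ≤ coboundaries M v p := by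
  rintro x ⟨hx, hxv⟩
  have hvx : osVec k M v * x = 0 := by
    have h : x * osVec k M v = 0 := hxv
    rw [mul_osVec v hx] at h
    exact (smul_eq_zero.1 h).resolve_left (pow_ne_zero _ (neg_ne_zero.2 one_ne_zero))
  cases p with
  | zero => exact (Submodule.mem_bot k).2 (h0 rfl x hx hvx)
  | succ r =>
    obtain ⟨y, hy, rfl⟩ := hs r rfl x hx hvx
    refine ⟨(-1 : k) ^ r • y, Submodule.smul_mem _ _ hy, ?_⟩
    rw [LinearMap.mulRight_apply, smul_mul_assoc, mul_osVec v hy, smul_smul, ← mul_pow,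
      neg_one_mul, neg_neg, one_pow, one_smul]

/-- There is an extension field with a vector all of whose partial sums are nonzero. -/
theorem exists_generic (k : Type*) [Field k] (n : ℕ) :
    ∃ w : Fin n → FractionRing (Polynomial k), ∀ X : Finset (Fin n), X.Nonempty →
      ∑ i ∈ X, w i ≠ 0 := by
  -- Distinct powers of the variable are linearly independent over k. A small finite k may contain
  -- no such vector, hence the extension.
  refine ⟨fun i => algebraMap _ _ ((Polynomial.X : Polynomial k) ^ (i : ℕ)), ?_⟩
  rintro X ⟨j, hj⟩ h
  rw [← map_sum, map_eq_zero_iff _ (IsFractionRing.injective (Polynomial k) _)] at h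
  have h1 := congrArg (fun q => Polynomial.coeff q (j : ℕ)) h
  simp [Polynomial.coeff_X_pow, Fin.val_inj, hj] at h1

/-- A loop i puts ∂e_i = 1 into the ideal. -/
theorem subsingleton_osAlgebra_of_loop {i : Fin n} (hi : M.IsCircuit {i}) :
    ∀ x : OSAlgebra k M, x = 0 := by
  have h : extBoundary k n (extMonomial k {i}) ∈ osIdeal k M :=
    TwoSidedIdeal.subset_span ⟨{i}, by simpa using hi, rfl⟩
  rw [extBoundary_eq, extMonomial_eq, Finset.sort_singleton, extList_cons, extContract_extE_mul,
    extList_nil, extContract_one, if_pos (Finset.mem_univ _), mul_zero, sub_zero,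
    ← osMk_eq_zero_iff, map_one] at h
  intro x
  rw [← mul_one x, h, mul_zero]

/-- The cohomology vanishes in degree `p` unless `v` has zero coordinate sum and zero sum on an
irreducible flat of rank at most `p + 1`. -/
theorem cocycles_le_coboundaries (hn : 0 < n) (hE : M.E = Set.univ) (v : Fin n → k) (p : ℕ)
    (h : ∀ X ∈ irrFlats M (p + 1), ∑ i, v i = 0 → ∑ i ∈ X, v i ≠ 0) :
    cocycles M v p ≤ coboundaries M v p := by
  by_cases hloop : ∀ i, M.Indep {i}
  swap
  · push Not at hloop
    obtain ⟨i, hi⟩ := hloop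
    have hd : M.Dep {i} := ⟨hi, by simp [hE]⟩
    obtain ⟨C, hCi, hC⟩ := hd.exists_isCircuit_subset
    rw [hC.nonempty.subset_singleton_iff.1 hCi] at hC
    intro x _
    rw [subsingleton_osAlgebra_of_loop hC x]
    exact zero_mem _
  let K := FractionRing (Polynomial k)
  obtain ⟨w, hw⟩ := exists_generic k n
  have hdesc := exact_descend (M := M) K v
  by_cases hv : ∑ i, v i = 0
  · have hwu : ∑ i, w i ≠ 0 := hw _ ⟨⟨0, hn⟩, Finset.mem_univ _⟩
    have hwex := scDiff_exact_of_sum_ne_zero (k := k) hE w hwu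
    have hne : ∀ Z : Flats M, 1 ≤ flatRank Z → Z.1.Nonempty := fun Z hZ => by
      rw [Finset.nonempty_iff_ne_empty]
      intro h0
      have := eRk_flat Z
      rw [h0, Finset.coe_empty, Matroid.eRk_empty] at this
      have : (0 : ℕ) = flatRank Z := by exact_mod_cast this
      omega
    -- For generic w, the flat Z itself serves as the union of components.
    have hLw : ∀ m, LocallyExact (flatRank (M := M)) (scDegree k M K) (scProj k K) m
        (scDiff k M w) := fun m =>
      locallyExact_scDiff w fun Z hZ _ =>
        ⟨Z.1, subset_rfl, fun C hC _ => Or.inl hC, hw _ (hne Z hZ)⟩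
    have hLv : LocallyExact (flatRank (M := M)) (scDegree k M K) (scProj k K) (p + 1)
        (scDiff k M fun i => algebraMap k K (v i)) := by
      refine locallyExact_scDiff _ fun Z hZ hZp => ?_
      -- For v, a connected component X of Z serves: it is an irreducible flat of rank at most p +
      -- 1, where the hypothesis gives a nonzero sum.
      obtain ⟨X, hXZ, hXf, hXc, hX⟩ := exists_component hE hloop Z.2
        (Finset.coe_nonempty.2 (hne Z hZ))
      have hcoe := (Set.toFinite X).coe_toFinset
      refine ⟨(Set.toFinite X).toFinset, ?_, ?_, ?_⟩
      · rw [← Finset.coe_subset, hcoe]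
        exact hXZ
      · rw [hcoe]
        exact hX
      · rw [← map_sum, map_ne_zero_iff _ (algebraMap k K).injective]
        refine h _ ⟨?_, ?_, ?_⟩ hv
        · rwa [hcoe]
        · rwa [hcoe]
        · rw [hcoe]
          refine (M.eRk_mono hXZ).trans ?_
          rw [eRk_flat]
          exact_mod_cast hZp
    have hP := flatProjections (k := k) K hE
    refine cocycles_le_coboundaries_of_exact v p ?_ ?_
    · rintro rfl
      exact hdesc.1 fun x hx => exact_zero_transfer hP hLv (hLw 1) hwex.1 hx
    · rintro r rfl
      exact hdesc.2 r fun x hx =>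
        exact_succ_transfer hP hLv (hLw (r + 2)) (hwex.2 r) hx
  · have hu : ∑ i, algebraMap k K (v i) ≠ 0 := by
      rwa [← map_sum, map_ne_zero_iff _ (algebraMap k K).injective]
    have hex := scDiff_exact_of_sum_ne_zero (k := k) hE _ hu
    exact cocycles_le_coboundaries_of_exact v p (fun _ => hdesc.1 hex.1)
      fun r _ => hdesc.2 r (hex.2 r)

end Vanishing
end HigherResonance
end

/-! ### The resonance theorem -/

theorem mainTheorem4 (k : Type*) [Field k] {n : ℕ} (hn : 0 < n)
    (M : Matroid (Fin n)) (hE : M.E = Set.univ) (l : ℕ) (hl : M.eRank = l)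
    (p : ℕ) (hp : p ≤ l) :
    (HigherResonance.resonance k M p 1 ⊆
      ⋃ X ∈ HigherResonance.irrFlats M (p + 1),
        (HigherResonance.partSubspace k {X, Xᶜ} : Set (Fin n → k))) ∧
    (∀ v : Fin n → k, Nontrivial (HigherResonance.OSCohomology M v p) →
      ∃ X ∈ HigherResonance.irrFlats M (p + 1),
        ∑ i, v i = 0 ∧ ∑ i ∈ X, v i = 0) := by
  have main : ∀ v : Fin n → k, Nontrivial (HigherResonance.OSCohomology M v p) →
      ∃ X ∈ HigherResonance.irrFlats M (p + 1), ∑ i, v i = 0 ∧ ∑ i ∈ X, v i = 0 := by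
    intro v hv
    by_contra! hc
    have hle := HigherResonance.cocycles_le_coboundaries hn hE v p hc
    rw [Submodule.Quotient.nontrivial_iff, ne_eq, Submodule.submoduleOf_eq_top] at hv
    exact hv hle
  refine ⟨fun v hv => ?_, main⟩
  have hv' : ((1 : ℕ) : Cardinal) ≤ Module.rank k (HigherResonance.OSCohomology M v p) := hv
  rw [Nat.cast_one, Cardinal.one_le_iff_pos, rank_pos_iff_nontrivial] at hv'
  obtain ⟨X, hX, h0, hX0⟩ := main v hv'
  refine Set.mem_biUnion hX ?_
  rintro B (rfl | rfl)
  · exact hX0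
  · rwa [← Finset.sum_add_sum_compl X, hX0, zero_add] at h0
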